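/- Let $L$ be a finite (nonempty) distributive lattice and $K$ a field. Let $T=K[z_a : a\in L]$. A Hibi relation is a nonzero polynomial $z_az_b-z_{a\wedge b}z_{a\vee b}$ (so $a,b\in L$ are incomparable), and $I_L\subset T$ is the ideal generated by all Hibi relations. Let $<$ be a rank lexicographic order on $T$, that is, the lexicographic order induced by a total order of the variables such that $z_a<z_b$ whenever $\operatorname{rank} a<\operatorname{rank} b$. For $a\le b$ in $L$, a complementary set of the interval $[a,b]$ is a set $\{c,d\}\ne\{a,b\}$ with $c,d\in[a,b]$, $c\vee d=b$ and $c\wedge d=a$; the interval is complemented if it has a complementary set. $L$ is conditionally URC if every interval of $L$ has at most one complementary set. The Hibi relations are indispensable if each of them belongs, up to sign, to every minimal set of binomial generators of $I_L$ (a binomial being a difference of two monomials). A full sublattice of $\{0,\dots,m\}\times\{0,\dots,n\}$ is a sublattice $D$ that contains a chain of length $m+n$. Let $(i,j)\in D$ with $(i\pm1,j),(i,j\pm1)\in D$. Then $(i,j)$ is an upper corner if $(i-1,j+1)\notin D$ and $(i+1,j-1)\in D$, a lower corner if $(i-1,j+1)\in D$ and $(i+1,j-1)\notin D$, and a critical corner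 if $(i-1,j+1)\notin D$ and $(i+1,j-1)\notin D$. $D$ is a chain ladder if its upper and lower corners form a chain and any two corners $(i,j)\ne(i',j')$ satisfy $i\ne i'$ and $j\ne j'$. Then the following conditions are equivalent: (a) The reduced Gröbner basis of $I_L$ with respect to $<$ is the set of all Hibi relations (up to sign, i.e. the set of all $z_{a\wedge b}z_{a\vee b}-z_az_b$ with $a,b\in L$ incomparable). (b) The Hibi relations are indispensable, and the reduced Gröbner basis of $I_L$ with respect to $<$ consists of quadratic polynomials. (c) $L$ is conditionally URC, and for all $a<b<c$ in $L$ such that $[a,b]$ and $[b,c]$ are complemented, with $\{g,h\}$ the complementary set of $[a,b]$, at least one of $[g,c]$ and $[h,c]$ is complemented. (d) $L$ is isomorphic to a chain ladder without critical corners, for some integers $m,n\ge0$. -/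

import Mathlib

open scoped MonomialOrder

namespace Hibi

section Monomials

variable {L : Type*}

/-- A rank lexicographic order on the monomials of `K[z_a : a ∈ L]`: the lexicographic order
induced by some strict total order `r` of the variables (`r a b` reads `z_a < z_b`)
such that `z_a < z_b` whenever `rank a < rank b`.
The largest variable in which two monomials differ decides. -/
def IsRankLex [Preorder L] (m : MonomialOrder L) : Prop :=
  ∃ r : L → L → Prop, IsStrictTotalOrder L r ∧
    (∀ a b : L, Order.height a < Order.height b → r a b) ∧
    ∀ s t : L →₀ ℕ, s ≺[m] t ↔ ∃ a : L, (∀ b : L, r a b → s b = t b) ∧ s a < t a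

variable {K : Type*} [Field K]

/-- A finite subset `G` of the ideal `I` is a Gröbner basis of `I` if the leading terms of the
elements of `G` generate the initial ideal of `I`. -/
def IsGroebnerBasis (m : MonomialOrder L) (I : Ideal (MvPolynomial L K))
    (G : Set (MvPolynomial L K)) : Prop :=
  G.Finite ∧ G ⊆ (I : Set (MvPolynomial L K)) ∧
    Ideal.span (m.leadingTerm '' G) =
      Ideal.span (m.leadingTerm '' (I : Set (MvPolynomial L K)))

/-- A Gröbner basis is reduced if its elements are monic and no monomial of one of them
is divisible by the leading monomial of another one. -/
def IsReducedGroebnerBasis (m : MonomialOrder L) (I : Ideal (MvPolynomial L K))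
    (G : Set (MvPolynomial L K)) : Prop :=
  IsGroebnerBasis m I G ∧ (∀ f ∈ G, m.Monic f) ∧
    ∀ f ∈ G, ∀ g ∈ G, f ≠ g → ∀ s ∈ f.support, ¬ m.degree g ≤ s

/-- A binomial is a difference of two monomials. -/
def IsBinomial (f : MvPolynomial L K) : Prop :=
  ∃ s t : L →₀ ℕ, f = MvPolynomial.monomial s 1 - MvPolynomial.monomial t 1

/-- `S` is a minimal set of binomial generators of `I`. -/
def IsMinimalBinomialGenerators (I : Ideal (MvPolynomial L K))
    (S : Set (MvPolynomial L K)) : Prop :=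
  (∀ f ∈ S, IsBinomial f) ∧ Ideal.span S = I ∧ ∀ S' : Set (MvPolynomial L K), S' ⊂ S →
    Ideal.span S' ≠ I

/-- `f` is indispensable for `I` if it appears, up to sign, in every minimal set of binomial
generators of `I`. -/
def IsIndispensable (I : Ideal (MvPolynomial L K)) (f : MvPolynomial L K) : Prop :=
  ∀ S : Set (MvPolynomial L K), IsMinimalBinomialGenerators I S → f ∈ S ∨ -f ∈ S

end Monomials

section Ideal

variable {L : Type*} [Lattice L] (K : Type*) [Field K]

/-- The Hibi relation `z_a z_b - z_{a ∧ b} z_{a ∨ b}`. It is nonzero exactly when `a` and `b`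
are incomparable. -/
noncomputable def hibiRelation (a b : L) : MvPolynomial L K :=
  MvPolynomial.X a * MvPolynomial.X b - MvPolynomial.X (a ⊓ b) * MvPolynomial.X (a ⊔ b)

variable (L) in
/-- The Hibi relation ideal `I_L`. -/
noncomputable def hibiIdeal : Ideal (MvPolynomial L K) :=
  Ideal.span {f | ∃ a b : L, f = hibiRelation K a b}

variable (L) in
/-- The set of all nonzero Hibi relations, with the sign chosen such that
`z_{a ∧ b} z_{a ∨ b}`, their leading monomial for every rank lexicographic order,
has coefficient `1`. -/
def monicHibiRelations : Set (MvPolynomial L K) :=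
  {f | ∃ a b : L, ¬ a ≤ b ∧ ¬ b ≤ a ∧ f = - hibiRelation K a b}

end Ideal

section Lattices

variable {L : Type*} [Lattice L]

/-- `{c, d}` is a complementary set of the interval `[a, b]`. -/
def IsComplementarySet (a b c d : L) : Prop :=
  c ∈ Set.Icc a b ∧ d ∈ Set.Icc a b ∧ c ⊔ d = b ∧ c ⊓ d = a ∧ ({c, d} : Set L) ≠ {a, b}

/-- The interval `[a, b]` is complemented: it admits a complementary set. -/
def IsComplementedInterval (a b : L) : Prop :=
  ∃ c d : L, IsComplementarySet a b c d

variable (L) in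
/-- Conditionally uniquely relatively complemented lattices: a complementary set of an interval
is unique, provided it exists. -/
def IsConditionallyURC : Prop :=
  ∀ a b c d c' d' : L, IsComplementarySet a b c d → IsComplementarySet a b c' d' →
    ({c, d} : Set L) = {c', d'}

end Lattices

section Ladders

/-- `D` is a full sublattice of `{0, …, m} × {0, …, n}`: it contains a chain of length `m + n`. -/
def IsFullSublattice (m n : ℕ) (D : Sublattice (ℤ × ℤ)) : Prop :=
  (D : Set (ℤ × ℤ)) ⊆ Set.Icc (0, 0) ((m : ℤ), (n : ℤ)) ∧ ∃ p : LTSeries D, p.length = m + n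

/-- `(i, j)` and its four horizontal and vertical neighbours belong to `D`. -/
def HasFourNeighbours (D : Sublattice (ℤ × ℤ)) (p : ℤ × ℤ) : Prop :=
  p ∈ D ∧ (p.1 - 1, p.2) ∈ D ∧ (p.1 + 1, p.2) ∈ D ∧ (p.1, p.2 + 1) ∈ D ∧ (p.1, p.2 - 1) ∈ D

def IsUpperCorner (D : Sublattice (ℤ × ℤ)) (p : ℤ × ℤ) : Prop :=
  HasFourNeighbours D p ∧ (p.1 - 1, p.2 + 1) ∉ D ∧ (p.1 + 1, p.2 - 1) ∈ D

def IsLowerCorner (D : Sublattice (ℤ × ℤ)) (p : ℤ × ℤ) : Prop :=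
  HasFourNeighbours D p ∧ (p.1 - 1, p.2 + 1) ∈ D ∧ (p.1 + 1, p.2 - 1) ∉ D

def IsCriticalCorner (D : Sublattice (ℤ × ℤ)) (p : ℤ × ℤ) : Prop :=
  HasFourNeighbours D p ∧ (p.1 - 1, p.2 + 1) ∉ D ∧ (p.1 + 1, p.2 - 1) ∉ D

def IsCorner (D : Sublattice (ℤ × ℤ)) (p : ℤ × ℤ) : Prop :=
  IsUpperCorner D p ∨ IsLowerCorner D p ∨ IsCriticalCorner D p

/-- A full sublattice of `{0, …, m} × {0, …, n}` is a chain ladder if its upper and lower corners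
form a chain and any two different corners differ in both coordinates. -/
def IsChainLadder (m n : ℕ) (D : Sublattice (ℤ × ℤ)) : Prop :=
  IsFullSublattice m n D ∧
    IsChain (· ≤ ·) {p | IsUpperCorner D p ∨ IsLowerCorner D p} ∧
    ∀ p q : ℤ × ℤ, IsCorner D p → IsCorner D q → p ≠ q → p.1 ≠ q.1 ∧ p.2 ≠ q.2

end Ladders

end Hibi

/-!
Monomials are encoded as multisets of elements of `L`, and the Hibi relations are read as a
rewriting relation `HibiStep` on them, replacing `z_{a ∧ b} z_{a ∨ b}` by `z_a z_b`. For a rank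
lexicographic order `z_{a ∧ b} z_{a ∨ b}` is the larger of the two monomials
(`expo_lt_of_hibiStep`), so the rewriting terminates. The monomials fall into classes, generated
by `HibiStep` as an equivalence relation, and `I_L` consists of the polynomials whose coefficients
sum to zero over every class (`mon_sub_mon_mem`, `classMap_eq_zero`). Its initial ideal is therefore
spanned by the monomials that are not the smallest ones of their class, and the Hibi relations are a
Gröbner basis if and only if each such monomial can be rewritten (`HasReductions`). They are
moreover reduced if and only if `z_{a ∧ b} z_{a ∨ b}` determines `{a, b}`, that is, if `L` is
conditionally URC (`isReducedGroebnerBasis_iff`).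

*Indispensability.* `L` is conditionally URC if and only if the classes of degree two have at most
two elements, which is what makes the Hibi relations indispensable. In that case a quadratic
Gröbner basis has the same initial monomials as the Hibi relations.

*Consecutive complemented intervals.* Let `{g, h}` and `{p, q}` be the complementary sets of
`[a, b]` and `[b, c]`. If neither `[g, c]` nor `[h, c]` is complemented, then `z_g z_h z_c` cannot
be rewritten and arises in one step only from `z_a z_b z_c`. The monomial `z_a z_p z_q` of the same
class is smaller than `z_a z_b z_c`, so it cannot be rewritten to `z_g z_h z_c`, and irreducible
monomials are not unique in this class (`isComplementedInterval_of_hasReductions`).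

*Planarity.* In a conditionally URC lattice no three join-irreducible elements are pairwise
incomparable, since they would give an interval with several complementary sets. So by Dilworth's
theorem the join-irreducible elements form two chains, and counting the members of each chain
below an element embeds `L` as a full sublattice `D` of a product of two chains
(`exists_isFullSublattice_of_isConditionallyURC`). A complemented
interval is now a rectangle contained in `D`, and the condition on consecutive complemented
intervals says: if two rectangles in `D` meet in a vertex, being the upper right one of the
first and the lower left one of the second, then `D` contains one of the two other vertices of
their hull. The absence of both vertices amounts to an upper corner weakly to the upper left of a
lower corner, and this is what a chain ladder without critical corners excludes
(`isChainLadder_and_iff`).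

*Confluence.* By Newman's lemma irreducible monomials are unique in their class as soon as rewriting
is locally confluent. Only rectangles sharing a vertex matter. Two rectangles with the same
lower left, or the same upper right, vertex are always confluent, and two consecutive ones are
by the condition on hulls (`IsGrid.locallyConfluent`).
-/

namespace Hibi

/-! ### Terminating relations -/

section Newman

variable {α : Type*} {r : α → α → Prop}

/-- Newman's lemma: a terminating, locally confluent relation is confluent. -/
theorem newman (wf : WellFounded (flip r))
    (lc : ∀ a b c, r a b → r a c → Relation.Join (Relation.ReflTransGen r) b c) (a : α) :
    ∀ b c, Relation.ReflTransGen r a b → Relation.ReflTransGen r a c →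
      Relation.Join (Relation.ReflTransGen r) b c := by
  induction a using wf.induction with
  | _ a ih =>
    intro b c hab hac
    rcases Relation.ReflTransGen.cases_head hab with rfl | ⟨b₁, hab₁, hb₁b⟩
    · exact ⟨c, hac, .refl⟩
    rcases Relation.ReflTransGen.cases_head hac with rfl | ⟨c₁, hac₁, hc₁c⟩
    · exact ⟨b, .refl, hab⟩
    obtain ⟨d, hb₁d, hc₁d⟩ := lc a b₁ c₁ hab₁ hac₁
    obtain ⟨x, hbx, hdx⟩ := ih b₁ hab₁ b d hb₁b hb₁d
    obtain ⟨y, hxy, hcy⟩ := ih c₁ hac₁ x c (hc₁d.trans hdx) hc₁c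
    exact ⟨y, hbx.trans hxy, hcy⟩

theorem join_of_eqvGen (wf : WellFounded (flip r))
    (lc : ∀ a b c, r a b → r a c → Relation.Join (Relation.ReflTransGen r) b c) {a b : α}
    (h : Relation.EqvGen r a b) : Relation.Join (Relation.ReflTransGen r) a b := by
  have he : Equivalence (Relation.Join (Relation.ReflTransGen r)) :=
    Relation.equivalence_join (newman wf lc)
  induction h with
  | rel x y hxy => exact ⟨y, .single hxy, .refl⟩
  | refl x => exact he.refl x
  | symm x y _ ih => exact he.symm ih
  | trans x y z _ _ ih₁ ih₂ => exact he.trans ih₁ ih₂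

end Newman

/-! ### Rewriting monomials by Hibi relations -/

section Rewriting

variable {L : Type*} [Lattice L]

/-- The rewriting relation on monomials, encoded as multisets of elements of `L`, that is given by
the monic Hibi relations: a factor `z_{a ∧ b} z_{a ∨ b}`, with `a` and `b` incomparable,
is replaced by `z_a z_b`. -/
def HibiStep (M N : Multiset L) : Prop :=
  ∃ (a b : L) (R : Multiset L), ¬ a ≤ b ∧ ¬ b ≤ a ∧
    M = (a ⊓ b) ::ₘ (a ⊔ b) ::ₘ R ∧ N = a ::ₘ b ::ₘ R

theorem HibiStep.add_left {M N : Multiset L} (h : HibiStep M N) (R : Multiset L) :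
    HibiStep (R + M) (R + N) := by
  obtain ⟨a, b, S, hab, hba, rfl, rfl⟩ := h
  exact ⟨a, b, R + S, hab, hba, by simp, by simp⟩

theorem eqvGen_add_left {M N : Multiset L} (h : Relation.EqvGen HibiStep M N) (R : Multiset L) :
    Relation.EqvGen HibiStep (R + M) (R + N) := by
  induction h with
  | rel x y hxy => exact .rel _ _ (hxy.add_left R)
  | refl x => exact .refl _
  | symm x y _ ih => exact .symm _ _ ih
  | trans x y z _ _ ih₁ ih₂ => exact .trans _ _ _ ih₁ ih₂

variable (L) in
/-- The congruence on monomials generated by the Hibi relations. -/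
def hibiCon : AddCon (Multiset L) where
  toSetoid := Relation.EqvGen.setoid HibiStep
  add' := by
    intro M N M' N' h h'
    refine Relation.EqvGen.trans _ (M + N') _ (eqvGen_add_left h' M) ?_
    rw [add_comm M, add_comm N]
    exact eqvGen_add_left h N'

theorem hibiCon_iff {M N : Multiset L} : hibiCon L M N ↔ Relation.EqvGen HibiStep M N := Iff.rfl

theorem pair_eq_pair_iff {α : Type*} {a b c d : α} :
    ({a, b} : Multiset α) = {c, d} ↔ a = c ∧ b = d ∨ a = d ∧ b = c := by
  constructor
  · intro h
    rcases Multiset.cons_eq_cons.1 (show a ::ₘ {b} = c ::ₘ {d} from h) with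
      ⟨h₁, h₂⟩ | ⟨_, S, h₁, h₂⟩
    · exact .inl ⟨h₁, by simpa using h₂⟩
    · have hS : S = 0 := by
        have := congrArg Multiset.card h₁
        simpa using this
      subst hS
      exact .inr ⟨by simpa using h₂.symm, by simpa using h₁⟩
  · rintro (⟨rfl, rfl⟩ | ⟨rfl, rfl⟩)
    · rfl
    · exact Multiset.pair_comm _ _

theorem eq_pair_of_pair_eq_cons {α : Type*} {a b c d : α} {R : Multiset α}
    (h : ({a, b} : Multiset α) = c ::ₘ d ::ₘ R) : R = 0 ∧ (a = c ∧ b = d ∨ a = d ∧ b = c) := by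
  have hR : R = 0 := by
    have := congrArg Multiset.card h
    simpa using this
  subst hR
  exact ⟨rfl, pair_eq_pair_iff.1 h⟩

/-- The monomials `z_x z_y` with prescribed `x ∧ y` and `x ∨ y` form a union of classes. -/
theorem eqvGen_pair {M N : Multiset L} (h : Relation.EqvGen HibiStep M N) (e f : L) :
    (∃ x y, M = {x, y} ∧ x ⊓ y = e ∧ x ⊔ y = f) ↔ ∃ x y, N = {x, y} ∧ x ⊓ y = e ∧ x ⊔ y = f := by
  induction h with
  | rel M N h =>
    obtain ⟨a, b, R, hab, hba, rfl, rfl⟩ := h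
    constructor
    · rintro ⟨x, y, h, rfl, rfl⟩
      obtain ⟨rfl, ⟨rfl, rfl⟩ | ⟨rfl, rfl⟩⟩ := eq_pair_of_pair_eq_cons h.symm
      · exact ⟨a, b, rfl, by simp, by simp⟩
      · exact ⟨a, b, rfl, by simp, by simp⟩
    · rintro ⟨x, y, h, rfl, rfl⟩
      obtain ⟨rfl, ⟨rfl, rfl⟩ | ⟨rfl, rfl⟩⟩ := eq_pair_of_pair_eq_cons h.symm
      · exact ⟨_, _, rfl, by simp, by simp⟩
      · exact ⟨_, _, rfl, by simp [inf_comm], by simp [sup_comm]⟩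
  | refl x => rfl
  | symm x y _ ih => exact ih.symm
  | trans x y z _ _ ih₁ ih₂ => exact ih₁.trans ih₂

theorem isComplementarySet_iff {a b c d : L} :
    IsComplementarySet a b c d ↔ ¬ c ≤ d ∧ ¬ d ≤ c ∧ c ⊓ d = a ∧ c ⊔ d = b := by
  constructor
  · rintro ⟨-, -, rfl, rfl, hne⟩
    refine ⟨fun h => hne ?_, fun h => hne ?_, rfl, rfl⟩
    · simp [inf_eq_left.2 h, sup_eq_right.2 h]
    · simp [inf_eq_right.2 h, sup_eq_left.2 h, Set.pair_comm]
  · rintro ⟨hcd, hdc, rfl, rfl⟩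
    refine ⟨⟨inf_le_left, le_sup_left⟩, ⟨inf_le_right, le_sup_right⟩, rfl, rfl, fun h => ?_⟩
    have hc : c ∈ ({c ⊓ d, c ⊔ d} : Set L) := h ▸ Set.mem_insert _ _
    rcases hc with hc | hc
    · exact hcd (inf_eq_left.1 hc.symm)
    · exact hdc (sup_eq_left.1 (Set.mem_singleton_iff.1 hc).symm)

theorem set_pair_eq_iff_multiset {α : Type*} {a b c d : α} :
    ({a, b} : Set α) = {c, d} ↔ ({a, b} : Multiset α) = {c, d} := by
  rw [pair_eq_pair_iff, Set.pair_eq_pair_iff]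

theorem isConditionallyURC_iff :
    IsConditionallyURC L ↔ ∀ c d c' d' : L, ¬ c ≤ d → ¬ d ≤ c → ¬ c' ≤ d' → ¬ d' ≤ c' →
      c ⊓ d = c' ⊓ d' → c ⊔ d = c' ⊔ d' → ({c, d} : Multiset L) = {c', d'} := by
  simp only [IsConditionallyURC, isComplementarySet_iff, set_pair_eq_iff_multiset]
  constructor
  · intro h c d c' d' h₁ h₂ h₃ h₄ h₅ h₆
    exact h _ _ c d c' d' ⟨h₁, h₂, rfl, rfl⟩ ⟨h₃, h₄, h₅.symm, h₆.symm⟩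
  · rintro h _ _ c d c' d' ⟨h₁, h₂, rfl, rfl⟩ ⟨h₃, h₄, h₅, h₆⟩
    exact h c d c' d' h₁ h₂ h₃ h₄ h₅.symm h₆.symm

/-- In a conditionally URC lattice the classes of degree two have at most two elements. -/
theorem eq_or_eq_of_eqvGen_pair (hL : IsConditionallyURC L) {a b : L} (hab : ¬ a ≤ b)
    (hba : ¬ b ≤ a) {M : Multiset L} (h : Relation.EqvGen HibiStep {a, b} M) :
    M = {a, b} ∨ M = {a ⊓ b, a ⊔ b} := by
  obtain ⟨x, y, rfl, hi, hs⟩ := (eqvGen_pair h (a ⊓ b) (a ⊔ b)).1 ⟨a, b, rfl, rfl, rfl⟩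
  by_cases hxy : x ≤ y
  · right
    rw [← hi, ← hs, inf_eq_left.2 hxy, sup_eq_right.2 hxy]
  by_cases hyx : y ≤ x
  · right
    rw [← hi, ← hs, inf_eq_right.2 hyx, sup_eq_left.2 hyx, Multiset.pair_comm]
  exact .inl (isConditionallyURC_iff.1 hL x y a b hxy hyx hab hba hi hs)

end Rewriting

/-! ### The Hibi ideal and classes of monomials -/

section Polynomials

variable {L : Type*}

/-- The exponent vector of a monomial encoded as a multiset of variables. -/
noncomputable def expo : Multiset L ≃+ (L →₀ ℕ) :=
  haveI := Classical.decEq L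
  Multiset.toFinsupp

theorem expo_singleton (a : L) : expo {a} = Finsupp.single a 1 := by
  exact @Multiset.toFinsupp_singleton _ (Classical.decEq L) a

theorem expo_pair (a b : L) : expo {a, b} = Finsupp.single a 1 + Finsupp.single b 1 := by
  rw [Multiset.insert_eq_cons, ← Multiset.singleton_add, map_add, expo_singleton, expo_singleton]

variable (K : Type*) [Field K]

/-- The monomial with prescribed multiset of variables. -/
noncomputable def mon (M : Multiset L) : MvPolynomial L K := MvPolynomial.monomial (expo M) 1

theorem mon_add (M N : Multiset L) : mon K (M + N) = mon K M * mon K N := by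
  simp [mon, MvPolynomial.monomial_mul]

theorem mon_pair (a b : L) : mon K {a, b} = MvPolynomial.X a * MvPolynomial.X b := by
  rw [mon, expo_pair, MvPolynomial.X, MvPolynomial.X, MvPolynomial.monomial_mul, one_mul]

variable {K}

theorem degree_leadingCoeff_monomial_sub (m : MonomialOrder L) {s t : L →₀ ℕ} (h : t ≺[m] s) :
    m.degree (MvPolynomial.monomial s (1 : K) - MvPolynomial.monomial t 1) = s ∧
      m.leadingCoeff (MvPolynomial.monomial s (1 : K) - MvPolynomial.monomial t 1) = 1 := by
  classical
  have h' : m.degree (MvPolynomial.monomial t (1 : K)) ≺[m]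
      m.degree (MvPolynomial.monomial s (1 : K)) := by
    simpa [MonomialOrder.degree_monomial] using h
  constructor
  · rw [MonomialOrder.degree_sub_of_lt h']; simp [MonomialOrder.degree_monomial]
  · rw [MonomialOrder.leadingCoeff_sub_of_lt h']; simp

theorem leadingTerm_monomial_sub (m : MonomialOrder L) {s t : L →₀ ℕ} (h : t ≺[m] s) :
    m.leadingTerm (MvPolynomial.monomial s (1 : K) - MvPolynomial.monomial t 1) =
      MvPolynomial.monomial s 1 := by
  rw [MonomialOrder.leadingTerm, (degree_leadingCoeff_monomial_sub m h).1,
    (degree_leadingCoeff_monomial_sub m h).2]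

variable [Lattice L]

theorem hibiRelation_eq (a b : L) : hibiRelation K a b = mon K {a, b} - mon K {a ⊓ b, a ⊔ b} := by
  rw [hibiRelation, mon_pair, mon_pair]

theorem mon_sub_mon_mem {M N : Multiset L} (h : Relation.EqvGen HibiStep M N) :
    mon K M - mon K N ∈ hibiIdeal L K := by
  induction h with
  | rel M N h =>
    obtain ⟨a, b, R, -, -, rfl, rfl⟩ := h
    have h₁ : (a ⊓ b) ::ₘ (a ⊔ b) ::ₘ R = R + {a ⊓ b, a ⊔ b} := by
      simp only [Multiset.insert_eq_cons, ← Multiset.singleton_add]; abel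
    have h₂ : a ::ₘ b ::ₘ R = R + {a, b} := by
      simp only [Multiset.insert_eq_cons, ← Multiset.singleton_add]; abel
    rw [h₁, h₂, mon_add, mon_add, ← mul_sub, ← neg_sub, ← hibiRelation_eq]
    exact Ideal.mul_mem_left _ _ (neg_mem (Ideal.subset_span ⟨a, b, rfl⟩))
  | refl x => simp
  | symm x y _ ih => simpa using neg_mem ih
  | trans x y z _ _ ih₁ ih₂ => simpa using add_mem ih₁ ih₂

variable (L K) in
/-- The projection of the polynomial ring onto the monoid algebra of the classes of monomials. -/
noncomputable def classMap : MvPolynomial L K →ₐ[K] AddMonoidAlgebra K (hibiCon L).Quotient :=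
  MvPolynomial.aeval fun a => AddMonoidAlgebra.single (({a} : Multiset L) : (hibiCon L).Quotient) 1

theorem classMap_mon (M : Multiset L) :
    classMap L K (mon K M) = AddMonoidAlgebra.single (M : (hibiCon L).Quotient) 1 := by
  induction M using Multiset.induction_on with
  | empty =>
    have : mon K (0 : Multiset L) = 1 := by rw [mon, map_zero]; rfl
    rw [this, map_one, AddMonoidAlgebra.one_def]; rfl
  | cons a M ih =>
    rw [← Multiset.singleton_add, mon_add, map_mul, ih, AddCon.coe_add]
    have : mon K {a} = MvPolynomial.X a := by simp [mon, expo_singleton, MvPolynomial.X]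
    rw [this, classMap, MvPolynomial.aeval_X, AddMonoidAlgebra.single_mul_single, one_mul]

theorem classMap_eq_zero {f : MvPolynomial L K} (hf : f ∈ hibiIdeal L K) :
    classMap L K f = 0 := by
  have : hibiIdeal L K ≤ RingHom.ker (classMap L K) := by
    rw [hibiIdeal, Ideal.span_le]
    rintro _ ⟨a, b, rfl⟩
    rw [SetLike.mem_coe, RingHom.mem_ker, hibiRelation_eq, map_sub, classMap_mon, classMap_mon,
      sub_eq_zero]
    congr 1
    rw [AddCon.eq, hibiCon_iff]
    by_cases hab : a ≤ b
    · rw [inf_eq_left.2 hab, sup_eq_right.2 hab]; exact .refl _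
    by_cases hba : b ≤ a
    · rw [inf_eq_right.2 hba, sup_eq_left.2 hba, Multiset.pair_comm]; exact .refl _
    exact .symm _ _ (.rel _ _ ⟨a, b, 0, hab, hba, rfl, rfl⟩)
  exact this hf

theorem eqvGen_of_mon_sub_mon_mem {M N : Multiset L} (h : mon K M - mon K N ∈ hibiIdeal L K) :
    Relation.EqvGen HibiStep M N := by
  have h' := classMap_eq_zero h
  rw [map_sub, classMap_mon, classMap_mon, sub_eq_zero] at h'
  have := (Finsupp.single_left_inj (one_ne_zero (α := K))).1 (AddMonoidAlgebra.ofCoeff_injective h')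
  rwa [AddCon.eq] at this

/-- In an element of the Hibi ideal, no monomial is alone in its class. -/
theorem exists_ne_mem_support {f : MvPolynomial L K} (hf : f ∈ hibiIdeal L K) {M : Multiset L}
    (hM : expo M ∈ f.support) :
    ∃ N, N ≠ M ∧ expo N ∈ f.support ∧ Relation.EqvGen HibiStep M N := by
  classical
  by_contra! hcon
  have hf0 := classMap_eq_zero hf
  have hsum : f = ∑ s ∈ f.support, f.coeff s • mon K (expo.symm s) := by
    conv_lhs => rw [f.as_sum]
    refine Finset.sum_congr rfl fun s _ => ?_
    simp [mon, MvPolynomial.smul_monomial]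
  rw [hsum, map_sum] at hf0
  have h := congrArg (fun g => g.coeff (M : (hibiCon L).Quotient)) hf0
  simp only [map_smul, classMap_mon] at h
  rw [AddMonoidAlgebra.coeff_sum, Finsupp.finsetSum_apply, Finset.sum_eq_single (expo M)] at h
  · simp at h
    exact (MvPolynomial.mem_support_iff.1 hM) h
  · intro s hs hsM
    have hne : ((expo.symm s : Multiset L) : (hibiCon L).Quotient) ≠ M := by
      intro he
      rw [AddCon.eq] at he
      refine hcon (expo.symm s) (fun h => hsM ?_) (by simpa using hs) (.symm _ _ he)
      rw [← h]; simp
    simp [hne]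
  · exact fun h => absurd hM h

end Polynomials

/-! ### The Hibi relations as a Gröbner basis -/

section Groebner

variable {L : Type*} [Lattice L]

/-- The variable `z_{a ∨ b}` has the largest rank of the four that occur in a Hibi relation. -/
theorem expo_lt_of_hibiStep [Finite L] {ord : MonomialOrder L} (hord : IsRankLex ord)
    {M N : Multiset L} (h : HibiStep M N) : expo N ≺[ord] expo M := by
  obtain ⟨a, b, R, hab, hba, rfl, rfl⟩ := h
  have h₁ : (a ⊓ b) ::ₘ (a ⊔ b) ::ₘ R = R + {a ⊓ b, a ⊔ b} := by
    simp only [Multiset.insert_eq_cons, ← Multiset.singleton_add]; abel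
  have h₂ : a ::ₘ b ::ₘ R = R + {a, b} := by
    simp only [Multiset.insert_eq_cons, ← Multiset.singleton_add]; abel
  rw [h₁, h₂, map_add, map_add, map_add, map_add]
  refine add_lt_add_right ?_ _
  obtain ⟨r, hr, hrank, hlt⟩ := hord
  have hfin : ∀ x : L, Order.height x < ⊤ := by
    intro x
    have := Fintype.ofFinite L
    refine lt_top_iff_ne_top.2 fun h => ?_
    obtain ⟨p, -, hp⟩ := (Order.height_eq_top_iff (x := x)).1 h (Fintype.card L)
    exact absurd p.length_lt_card (by simp [hp])
  have ha : r a (a ⊔ b) := hrank _ _ (Order.height_strictMono (left_lt_sup.2 hba) (hfin _))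
  have hb : r b (a ⊔ b) := hrank _ _ (Order.height_strictMono (right_lt_sup.2 hab) (hfin _))
  have hi : r (a ⊓ b) (a ⊔ b) :=
    hrank _ _ (Order.height_strictMono (inf_lt_sup.2 fun h => hab h.le) (hfin _))
  have hne : ∀ {x y : L}, r x y → x ≠ y := by
    rintro x _ h rfl
    exact irrefl_of r x h
  rw [hlt]
  refine ⟨a ⊔ b, fun x hx => ?_, ?_⟩
  · rw [expo_pair, expo_pair]
    have hax : a ≠ x := hne (trans_of r ha hx)
    have hbx : b ≠ x := hne (trans_of r hb hx)
    have hix : a ⊓ b ≠ x := hne (trans_of r hi hx)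
    have hsx : a ⊔ b ≠ x := hne hx
    simp [hax, hbx, hix, hsx]
  · rw [expo_pair, expo_pair]
    simp [hne ha, hne hb]

theorem wellFounded_hibiStep [Finite L] {ord : MonomialOrder L} (hord : IsRankLex ord) :
    WellFounded (flip (HibiStep (L := L))) :=
  Subrelation.wf (fun {_ _} h => expo_lt_of_hibiStep hord h)
    (InvImage.wf (fun M => ord.toSyn (expo M)) wellFounded_lt)

/-- Each monomial that is not the smallest one of its class can be rewritten by a Hibi relation:
this is the combinatorial content of the Hibi relations being a Gröbner basis. -/
def HasReductions (ord : MonomialOrder L) : Prop :=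
  ∀ M N : Multiset L, Relation.EqvGen HibiStep M N → expo N ≺[ord] expo M → ∃ P, HibiStep M P

/-- The exponents of the monomials that are not the smallest ones of their class. -/
def nonMinimal (ord : MonomialOrder L) : Set (L →₀ ℕ) :=
  {s | ∃ M N : Multiset L, s = expo M ∧ Relation.EqvGen HibiStep M N ∧ expo N ≺[ord] expo M}

variable {K : Type*} [Field K] {ord : MonomialOrder L}

theorem degree_mem_nonMinimal {f : MvPolynomial L K} (hf : f ∈ hibiIdeal L K) (hf0 : f ≠ 0) :
    ord.degree f ∈ nonMinimal ord := by
  have hd := ord.degree_mem_support hf0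
  obtain ⟨M, hM⟩ := (expo (L := L)).surjective (ord.degree f)
  rw [← hM] at hd ⊢
  obtain ⟨N, hNM, hN, h⟩ := exists_ne_mem_support hf hd
  refine ⟨M, N, rfl, h, lt_of_le_of_ne ?_ fun he => hNM ?_⟩
  · rw [hM]; exact ord.le_degree hN
  · exact expo.injective (ord.toSyn.injective he)

variable (K) in
/-- The initial ideal of the Hibi ideal is spanned by the monomials that are not the smallest
ones of their class. -/
theorem span_leadingTerm_hibiIdeal (ord : MonomialOrder L) :
    Ideal.span (ord.leadingTerm '' (hibiIdeal L K : Set (MvPolynomial L K))) =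
      Ideal.span ((fun s => MvPolynomial.monomial s (1 : K)) '' nonMinimal ord) := by
  apply le_antisymm <;> rw [Ideal.span_le]
  · rintro _ ⟨f, hf, rfl⟩
    by_cases hf0 : f = 0
    · simp [hf0]
    rw [SetLike.mem_coe, MonomialOrder.leadingTerm, ← mul_one (ord.leadingCoeff f),
      ← MvPolynomial.C_mul_monomial]
    exact Ideal.mul_mem_left _ _ (Ideal.subset_span ⟨_, degree_mem_nonMinimal hf hf0, rfl⟩)
  · rintro _ ⟨_, ⟨M, N, rfl, h, hlt⟩, rfl⟩
    exact Ideal.subset_span ⟨_, mon_sub_mon_mem h, leadingTerm_monomial_sub ord hlt⟩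

theorem neg_hibiRelation_eq (a b : L) :
    -hibiRelation K a b = mon K {a ⊓ b, a ⊔ b} - mon K {a, b} := by
  rw [hibiRelation_eq, neg_sub]

theorem hibiStep_pair {a b : L} (hab : ¬ a ≤ b) (hba : ¬ b ≤ a) :
    HibiStep {a ⊓ b, a ⊔ b} {a, b} :=
  ⟨a, b, 0, hab, hba, rfl, rfl⟩

theorem degree_neg_hibiRelation [Finite L] (hord : IsRankLex ord) {a b : L} (hab : ¬ a ≤ b)
    (hba : ¬ b ≤ a) : ord.degree (-hibiRelation K a b) = expo {a ⊓ b, a ⊔ b} := by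
  rw [neg_hibiRelation_eq]
  exact (degree_leadingCoeff_monomial_sub ord
    (expo_lt_of_hibiStep hord (hibiStep_pair hab hba))).1

theorem monic_neg_hibiRelation [Finite L] (hord : IsRankLex ord) {a b : L} (hab : ¬ a ≤ b)
    (hba : ¬ b ≤ a) : ord.Monic (-hibiRelation K a b) := by
  rw [neg_hibiRelation_eq]
  exact (degree_leadingCoeff_monomial_sub ord
    (expo_lt_of_hibiStep hord (hibiStep_pair hab hba))).2

variable (K) in
theorem leadingTerm_monicHibiRelations [Finite L] (hord : IsRankLex ord) :
    ord.leadingTerm '' monicHibiRelations L K =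
      (fun s => MvPolynomial.monomial s (1 : K)) ''
        {s | ∃ a b : L, ¬ a ≤ b ∧ ¬ b ≤ a ∧ s = expo {a ⊓ b, a ⊔ b}} := by
  have key : ∀ {a b : L}, ¬ a ≤ b → ¬ b ≤ a →
      ord.leadingTerm (-hibiRelation K a b) = MvPolynomial.monomial (expo {a ⊓ b, a ⊔ b}) 1 := by
    intro a b hab hba
    rw [neg_hibiRelation_eq]
    exact leadingTerm_monomial_sub ord (expo_lt_of_hibiStep hord (hibiStep_pair hab hba))
  ext f
  constructor
  · rintro ⟨_, ⟨a, b, hab, hba, rfl⟩, rfl⟩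
    exact ⟨_, ⟨a, b, hab, hba, rfl⟩, (key hab hba).symm⟩
  · rintro ⟨_, ⟨a, b, hab, hba, rfl⟩, rfl⟩
    exact ⟨_, ⟨a, b, hab, hba, rfl⟩, key hab hba⟩

theorem expo_le_expo {α : Type*} {M N : Multiset α} : expo M ≤ expo N ↔ M ≤ N := by
  classical
  constructor
  · intro h
    obtain ⟨s, hs⟩ := exists_add_of_le h
    obtain ⟨P, rfl⟩ := (expo (L := α)).surjective s
    rw [← map_add] at hs
    exact expo.injective hs ▸ Multiset.le_add_right _ _
  · intro h
    obtain ⟨P, rfl⟩ := Multiset.le_iff_exists_add.1 h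
    rw [map_add]
    exact le_self_add

theorem exists_hibiStep_iff {M : Multiset L} :
    (∃ P, HibiStep M P) ↔ ∃ a b : L, ¬ a ≤ b ∧ ¬ b ≤ a ∧ {a ⊓ b, a ⊔ b} ≤ M := by
  constructor
  · rintro ⟨_, a, b, R, hab, hba, rfl, rfl⟩
    exact ⟨a, b, hab, hba, Multiset.cons_le_cons _ (Multiset.cons_le_cons _ (Multiset.zero_le _))⟩
  · rintro ⟨a, b, hab, hba, h⟩
    obtain ⟨R, rfl⟩ := Multiset.le_iff_exists_add.1 h
    exact ⟨_, a, b, R, hab, hba, by simp, rfl⟩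

theorem isGroebnerBasis_iff [Finite L] (hord : IsRankLex ord) :
    IsGroebnerBasis ord (hibiIdeal L K) (monicHibiRelations L K) ↔ HasReductions ord := by
  have hfin : (monicHibiRelations L K).Finite := by
    refine (Set.finite_range fun p : L × L => -hibiRelation K p.1 p.2).subset ?_
    rintro _ ⟨a, b, -, -, rfl⟩
    exact ⟨(a, b), rfl⟩
  have hsub : monicHibiRelations L K ⊆ hibiIdeal L K := by
    rintro _ ⟨a, b, -, -, rfl⟩
    exact neg_mem (Ideal.subset_span ⟨a, b, rfl⟩)
  have hle : Ideal.span (ord.leadingTerm '' monicHibiRelations L K) ≤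
      Ideal.span (ord.leadingTerm '' (hibiIdeal L K : Set (MvPolynomial L K))) :=
    Ideal.span_mono (Set.image_mono hsub)
  rw [IsGroebnerBasis, and_iff_right hfin, and_iff_right hsub, ← hle.ge_iff_eq,
    span_leadingTerm_hibiIdeal, leadingTerm_monicHibiRelations K hord, Ideal.span_le]
  constructor
  · intro h M N hMN hlt
    have hM := h ⟨_, ⟨M, N, rfl, hMN, hlt⟩, rfl⟩
    rw [SetLike.mem_coe, MvPolynomial.mem_ideal_span_monomial_image] at hM
    obtain ⟨_, ⟨a, b, hab, hba, rfl⟩, hle⟩ := hM (expo M) (by classical simp)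
    exact exists_hibiStep_iff.2 ⟨a, b, hab, hba, expo_le_expo.1 hle⟩
  · rintro h _ ⟨_, ⟨M, N, rfl, hMN, hlt⟩, rfl⟩
    obtain ⟨a, b, hab, hba, hle⟩ := exists_hibiStep_iff.1 (h M N hMN hlt)
    rw [SetLike.mem_coe, MvPolynomial.mem_ideal_span_monomial_image]
    intro s hs
    classical
    rw [MvPolynomial.support_monomial, if_neg one_ne_zero, Finset.mem_singleton] at hs
    exact ⟨_, ⟨a, b, hab, hba, rfl⟩, hs ▸ expo_le_expo.2 hle⟩

theorem support_neg_hibiRelation (a b : L) {s : L →₀ ℕ}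
    (hs : s ∈ (-hibiRelation K a b).support) : s = expo {a ⊓ b, a ⊔ b} ∨ s = expo {a, b} := by
  classical
  rw [neg_hibiRelation_eq] at hs
  have := MvPolynomial.support_sub L _ _ hs
  rw [Finset.mem_union] at this
  refine this.imp (fun h => ?_) fun h => ?_
  · exact Finset.mem_singleton.1 (MvPolynomial.support_monomial_subset h)
  · exact Finset.mem_singleton.1 (MvPolynomial.support_monomial_subset h)

theorem pair_le_pair_iff {α : Type*} {a b c d : α} : ({a, b} : Multiset α) ≤ {c, d} ↔
    ({a, b} : Multiset α) = {c, d} :=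
  ⟨fun h => Multiset.eq_of_le_of_card_le h (by simp), fun h => h.le⟩

/-- The Hibi relations are interreduced precisely if their initial monomials are distinct, that is,
if complementary sets are unique. -/
theorem isReducedGroebnerBasis_iff [Finite L] (hord : IsRankLex ord) :
    IsReducedGroebnerBasis ord (hibiIdeal L K) (monicHibiRelations L K) ↔
      IsConditionallyURC L ∧ HasReductions ord := by
  rw [IsReducedGroebnerBasis, isGroebnerBasis_iff hord, isConditionallyURC_iff]
  constructor
  · rintro ⟨hred, -, h⟩
    refine ⟨?_, hred⟩
    intro c d c' d' hcd hdc hcd' hdc' hi hs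
    by_contra hne
    refine h _ ⟨c, d, hcd, hdc, rfl⟩ _ ⟨c', d', hcd', hdc', rfl⟩ (fun he => hne ?_)
      (expo {c ⊓ d, c ⊔ d}) ?_ ?_
    · rw [neg_inj, hibiRelation_eq, hibiRelation_eq, hi, hs, sub_left_inj] at he
      exact expo.injective (MvPolynomial.monomial_left_injective one_ne_zero he)
    · rw [← degree_neg_hibiRelation (K := K) hord hcd hdc]
      exact ord.degree_mem_support (monic_neg_hibiRelation hord hcd hdc).ne_zero
    · rw [degree_neg_hibiRelation hord hcd' hdc', hi, hs]
  · rintro ⟨hL, hred⟩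
    refine ⟨hred, ?_, ?_⟩
    · rintro _ ⟨a, b, hab, hba, rfl⟩
      exact monic_neg_hibiRelation hord hab hba
    · rintro _ ⟨a, b, hab, hba, rfl⟩ _ ⟨a', b', hab', hba', rfl⟩ hne s hs hle
      rw [degree_neg_hibiRelation hord hab' hba'] at hle
      rcases support_neg_hibiRelation a b hs with rfl | rfl
      · rw [expo_le_expo, pair_le_pair_iff, pair_eq_pair_iff] at hle
        rcases hle with ⟨hi, hs⟩ | ⟨hi, hs⟩
        · refine hne ?_
          rw [hibiRelation_eq, hibiRelation_eq, hL a b a' b' hab hba hab' hba' hi.symm hs.symm,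
            hi, hs]
        · have h₁ : a' ⊓ b' ≤ a' ⊔ b' := inf_le_sup
          rw [hi, hs] at h₁
          exact hab (le_sup_left.trans (h₁.trans inf_le_right))
      · rw [expo_le_expo, pair_le_pair_iff, pair_eq_pair_iff] at hle
        have h₁ : a' ⊓ b' ≤ a' ⊔ b' := inf_le_sup
        rcases hle with ⟨hi, hs⟩ | ⟨hi, hs⟩
        · rw [hi, hs] at h₁; exact hab h₁
        · rw [hi, hs] at h₁; exact hba h₁

end Groebner

/-! ### Indispensability -/

section Indispensable

variable {L : Type*} [Lattice L] {K : Type*} [Field K]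

variable (K) in
theorem coeff_mon {α : Type*} [DecidableEq (Multiset α)] (M N : Multiset α) :
    MvPolynomial.coeff (expo M) (mon K N) = if N = M then 1 else 0 := by
  classical
  rw [mon, MvPolynomial.coeff_monomial]
  simp only [expo.injective.eq_iff]

/-- The monomials `z_a z_b` and `z_{a ∧ b} z_{a ∨ b}` form a whole class, and they are coprime.
Hence a monomial multiple `u f` of a binomial `f ∈ I_L` has coefficient `0` at `z_a z_b` unless
`u = 1` and `f` is, up to sign, the Hibi relation. -/
theorem isIndispensable_of_isConditionallyURC (hL : IsConditionallyURC L) {a b : L}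
    (hab : ¬ a ≤ b) (hba : ¬ b ≤ a) :
    IsIndispensable (hibiIdeal L K) (hibiRelation K a b) := by
  classical
  rintro S ⟨hbin, hspan, -⟩
  by_contra! hcon
  have hdisj : ∀ {u v w : Multiset L}, w + u = {a, b} → w + v = {a ⊓ b, a ⊔ b} → w = 0 := by
    intro u v w hu hv
    refine Multiset.eq_zero_of_forall_notMem fun x hx => ?_
    have h₁ : x ∈ ({a, b} : Multiset L) := hu ▸ Multiset.mem_add.2 (.inl hx)
    have h₂ : x ∈ ({a ⊓ b, a ⊔ b} : Multiset L) := hv ▸ Multiset.mem_add.2 (.inl hx)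
    simp only [Multiset.insert_eq_cons, Multiset.mem_cons, Multiset.mem_singleton] at h₁ h₂
    rcases h₁ with rfl | rfl <;> rcases h₂ with h | h
    · exact hab (inf_eq_left.1 h.symm)
    · exact hba (sup_eq_left.1 h.symm)
    · exact hba (inf_eq_right.1 h.symm)
    · exact hab (sup_eq_right.1 h.symm)
  have key : ∀ f ∈ S, ∀ s : L →₀ ℕ,
      MvPolynomial.coeff (expo {a, b}) (MvPolynomial.monomial s (1 : K) * f) = 0 := by
    intro f hf s
    obtain ⟨s₁, s₂, rfl⟩ := hbin f hf
    obtain ⟨M, rfl⟩ := (expo (L := L)).surjective s₁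
    obtain ⟨N, rfl⟩ := (expo (L := L)).surjective s₂
    obtain ⟨w, rfl⟩ := (expo (L := L)).surjective s
    have hMN : Relation.EqvGen HibiStep M N := by
      refine eqvGen_of_mon_sub_mon_mem (K := K) ?_
      rw [← hspan]
      exact Ideal.subset_span hf
    have hwMN := eqvGen_add_left hMN w
    change MvPolynomial.coeff _ (mon K w * (mon K M - mon K N)) = 0
    rw [mul_sub, ← mon_add, ← mon_add, MvPolynomial.coeff_sub, coeff_mon, coeff_mon]
    by_cases h₁ : w + M = {a, b} <;> by_cases h₂ : w + N = {a, b}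
    · rw [if_pos h₁, if_pos h₂, sub_self]
    · rw [h₁] at hwMN
      have h₃ := (eq_or_eq_of_eqvGen_pair hL hab hba hwMN).resolve_left h₂
      have hw := hdisj h₁ h₃
      rw [hw, zero_add] at h₁ h₃
      refine absurd ?_ hcon.1
      rw [hibiRelation_eq, ← h₁, ← h₃]
      exact hf
    · rw [h₂] at hwMN
      have h₃ := (eq_or_eq_of_eqvGen_pair hL hab hba (.symm _ _ hwMN)).resolve_left h₁
      have hw := hdisj h₂ h₃
      rw [hw, zero_add] at h₂ h₃
      refine absurd ?_ hcon.2
      rw [neg_hibiRelation_eq, ← h₂, ← h₃]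
      exact hf
    · rw [if_neg h₁, if_neg h₂, sub_zero]
  have hmem : hibiRelation K a b ∈ Ideal.span S := hspan ▸ Ideal.subset_span ⟨a, b, rfl⟩
  have hzero : ∀ f ∈ Ideal.span S, ∀ s : L →₀ ℕ,
      MvPolynomial.coeff (expo {a, b}) (MvPolynomial.monomial s (1 : K) * f) = 0 := by
    intro f hf
    induction hf using Submodule.span_induction with
    | mem f hf => exact key f hf
    | zero => simp
    | add f g _ _ hf hg => intro s; rw [mul_add, MvPolynomial.coeff_add, hf, hg, add_zero]
    | smul p f _ hf =>
      intro s
      rw [smul_eq_mul]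
      induction p using MvPolynomial.induction_on' with
      | monomial t c =>
        rw [← mul_assoc, MvPolynomial.monomial_mul, one_mul, ← mul_one c,
          ← MvPolynomial.C_mul_monomial, mul_assoc, MvPolynomial.coeff_C_mul, hf, mul_zero]
      | add p q hp hq => rw [add_mul, mul_add, MvPolynomial.coeff_add, hp, hq, add_zero]
  have h := hzero _ hmem 0
  rw [show (MvPolynomial.monomial 0 (1 : K) : MvPolynomial L K) = 1 from rfl, one_mul,
    hibiRelation_eq, MvPolynomial.coeff_sub, coeff_mon, coeff_mon] at h
  have hne : ({a ⊓ b, a ⊔ b} : Multiset L) ≠ {a, b} := by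
    intro he
    have := hdisj (u := 0) (v := 0) (w := {a, b}) (by simp) (by simpa using he.symm)
    simp at this
  rw [if_pos rfl, if_neg hne, sub_zero] at h
  exact one_ne_zero h

/-- If `{c, d}` and `{c', d'}` are different complementary sets of one interval, the relation of
the former is a sum of two other binomials of `I_L`, so the binomials of `I_L` other than this
relation still generate `I_L`. -/
theorem isConditionallyURC_of_isIndispensable [Finite L]
    (h : ∀ a b : L, ¬ a ≤ b → ¬ b ≤ a → IsIndispensable (hibiIdeal L K) (hibiRelation K a b)) :
    IsConditionallyURC L := by
  classical
  rw [isConditionallyURC_iff]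
  intro c d c' d' hcd hdc hcd' hdc' hi hs
  by_contra hne
  set I := hibiIdeal L K with hI
  let S₀ : Set (MvPolynomial L K) :=
    {f | f ∈ I ∧ IsBinomial f ∧ f ≠ hibiRelation K c d ∧ -f ≠ hibiRelation K c d}
  have hne' : ({c', d'} : Multiset L) ≠ {c ⊓ d, c ⊔ d} := by
    rw [hi, hs, Ne, pair_eq_pair_iff]
    rintro (⟨h₁, -⟩ | ⟨-, h₁⟩)
    · exact hcd' (inf_eq_left.1 h₁.symm)
    · exact hdc' (inf_eq_right.1 h₁.symm)
  -- All binomials with `z_{c'} z_{d'}` as a term are in `S₀`. Testing the coefficient of this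
  -- monomial also covers characteristic two, where signs do not distinguish binomials.
  have hh : MvPolynomial.coeff (expo {c', d'}) (hibiRelation K c d) = 0 := by
    rw [hibiRelation_eq, MvPolynomial.coeff_sub, coeff_mon, coeff_mon, if_neg hne, if_neg hne'.symm,
      sub_zero]
  have hS₀ : ∀ f, f ∈ I → IsBinomial f → MvPolynomial.coeff (expo {c', d'}) f ≠ 0 → f ∈ S₀ := by
    intro f hf hbin hf0
    refine ⟨hf, hbin, fun he => hf0 (he ▸ hh), fun he => hf0 ?_⟩
    rw [← he, MvPolynomial.coeff_neg, neg_eq_zero] at hh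
    exact hh
  have hclass : ∀ {x y : L}, ¬ x ≤ y → ¬ y ≤ x →
      Relation.EqvGen HibiStep {x ⊓ y, x ⊔ y} {x, y} := fun h₁ h₂ => .rel _ _ (hibiStep_pair h₁ h₂)
  have hspan : Ideal.span S₀ = I := by
    apply le_antisymm
    · exact Ideal.span_le.2 fun f hf => hf.1
    have hmem : hibiRelation K c d ∈ Ideal.span S₀ := by
      rw [hibiRelation_eq, ← sub_add_sub_cancel _ (mon K {c', d'})]
      refine add_mem (Ideal.subset_span (hS₀ _ (mon_sub_mon_mem ?_) ⟨_, _, rfl⟩ ?_))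
        (Ideal.subset_span (hS₀ _ (mon_sub_mon_mem ?_) ⟨_, _, rfl⟩ ?_))
      · refine .trans _ _ _ (.symm _ _ (hclass hcd hdc)) ?_
        rw [hi, hs]
        exact hclass hcd' hdc'
      · rw [MvPolynomial.coeff_sub, coeff_mon, coeff_mon, if_neg hne, if_pos rfl]
        simp
      · rw [hi, hs]
        exact .symm _ _ (hclass hcd' hdc')
      · rw [MvPolynomial.coeff_sub, coeff_mon, coeff_mon, if_neg hne'.symm, if_pos rfl]
        simp
    rw [hI, hibiIdeal, Ideal.span_le]
    rintro _ ⟨a, b, rfl⟩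
    by_cases h₁ : hibiRelation K a b = hibiRelation K c d
    · rw [SetLike.mem_coe, h₁]; exact hmem
    by_cases h₂ : -hibiRelation K a b = hibiRelation K c d
    · rw [SetLike.mem_coe, ← neg_neg (hibiRelation K a b), h₂]; exact neg_mem hmem
    exact Ideal.subset_span
      ⟨Ideal.subset_span ⟨a, b, rfl⟩, by rw [hibiRelation_eq]; exact ⟨_, _, rfl⟩, h₁, h₂⟩
  have hfg : (Ideal.span S₀).FG := IsNoetherian.noetherian _
  obtain ⟨F₀, hF₀, hF₀span⟩ := Submodule.fg_span_iff_fg_span_finset_subset S₀ |>.1 hfg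
  obtain ⟨F, hFF₀, hFmin⟩ := exists_minimal_le_of_wellFoundedLT
    (fun F : Finset (MvPolynomial L K) => Ideal.span (F : Set (MvPolynomial L K)) = I) F₀
    (hF₀span.symm.trans hspan)
  have hFS₀ : ∀ f ∈ F, f ∈ S₀ := fun f hf => hF₀ (hFF₀ hf)
  have hgen : IsMinimalBinomialGenerators I (F : Set (MvPolynomial L K)) := by
    refine ⟨fun f hf => (hFS₀ f hf).2.1, hFmin.1, fun S' hS' hspan' => ?_⟩
    have hfin : S'.Finite := F.finite_toSet.subset hS'.subset
    lift S' to Finset (MvPolynomial L K) using hfin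
    exact hS'.2 (Finset.coe_subset.2 (hFmin.2 hspan' (Finset.coe_subset.1 hS'.1)))
  rcases h c d hcd hdc F hgen with h | h
  · exact (hFS₀ _ h).2.2.1 rfl
  · exact (hFS₀ _ h).2.2.2 (neg_neg _)

theorem degree_expo {α : Type*} (M : Multiset α) : (expo M).degree = M.card := by
  induction M using Multiset.induction_on with
  | empty => simp
  | cons a M ih => rw [← Multiset.singleton_add, map_add, Finsupp.degree.map_add, ih,
    expo_singleton, Finsupp.degree_single, Multiset.card_add, Multiset.card_singleton]

/-- A Gröbner basis of quadrics has initial monomials that are not minimal in classes of degree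
two; if complementary sets are unique, these are the initial monomials of Hibi relations. -/
theorem hasReductions_of_homogeneous [Finite L] {ord : MonomialOrder L} (hord : IsRankLex ord)
    (hL : IsConditionallyURC L) {G : Set (MvPolynomial L K)}
    (hG : IsReducedGroebnerBasis ord (hibiIdeal L K) G) (hG2 : ∀ f ∈ G, f.IsHomogeneous 2) :
    HasReductions ord := by
  classical
  intro M N hMN hlt
  obtain ⟨⟨-, hGI, hspan⟩, hmonic, -⟩ := hG
  have hmem : MvPolynomial.monomial (expo M) (1 : K) ∈ Ideal.span (ord.leadingTerm '' G) := by
    rw [hspan, span_leadingTerm_hibiIdeal]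
    exact Ideal.subset_span ⟨_, ⟨M, N, rfl, hMN, hlt⟩, rfl⟩
  have himg : ord.leadingTerm '' G = (fun s => MvPolynomial.monomial s (1 : K)) ''
      (ord.degree '' G) := by
    rw [Set.image_image]
    refine Set.image_congr fun f hf => ?_
    rw [MonomialOrder.leadingTerm, (hmonic f hf).leadingCoeff_eq_one]
  rw [himg, MvPolynomial.mem_ideal_span_monomial_image] at hmem
  obtain ⟨_, ⟨g, hg, rfl⟩, hle⟩ := hmem (expo M) (by simp)
  have hg0 := (hmonic g hg).ne_zero
  obtain ⟨P, Q, hP, hPQ, hlt'⟩ := degree_mem_nonMinimal (ord := ord) (hGI hg) hg0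
  have hcard : P.card = 2 := by
    rw [← degree_expo, ← hP]
    have := hG2 g hg (MvPolynomial.mem_support_iff.1 (ord.degree_mem_support hg0))
    rw [Finsupp.degree_eq_weight_one]
    exact this
  rw [hP, expo_le_expo] at hle
  obtain ⟨x, y, rfl⟩ := Multiset.card_eq_two.1 hcard
  have hPne : Q ≠ {x, y} := by
    rintro rfl
    exact lt_irrefl _ hlt'
  rw [exists_hibiStep_iff]
  by_cases hxy : ¬ x ≤ y ∧ ¬ y ≤ x
  · have hQ := (eq_or_eq_of_eqvGen_pair hL hxy.1 hxy.2 hPQ).resolve_left hPne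
    exact absurd (hQ ▸ expo_lt_of_hibiStep hord (hibiStep_pair hxy.1 hxy.2)) hlt'.asymm
  have hpair : ({x, y} : Multiset L) = {x ⊓ y, x ⊔ y} := by
    by_cases h : x ≤ y
    · rw [inf_eq_left.2 h, sup_eq_right.2 h]
    · have h' : y ≤ x := by tauto
      rw [inf_eq_right.2 h', sup_eq_left.2 h', Multiset.pair_comm]
  obtain ⟨u, v, rfl, hi, hs⟩ := (eqvGen_pair hPQ (x ⊓ y) (x ⊔ y)).1 ⟨x, y, rfl, rfl, rfl⟩
  refine ⟨u, v, fun h => hPne ?_, fun h => hPne ?_, ?_⟩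
  · rw [hpair, ← hi, ← hs, inf_eq_left.2 h, sup_eq_right.2 h]
  · rw [hpair, ← hi, ← hs, inf_eq_right.2 h, sup_eq_left.2 h, Multiset.pair_comm]
  · rwa [hi, hs, ← hpair]

theorem isHomogeneous_hibiRelation (a b : L) : (hibiRelation K a b).IsHomogeneous 2 :=
  ((MvPolynomial.isHomogeneous_X K a).mul (MvPolynomial.isHomogeneous_X K b)).sub
    ((MvPolynomial.isHomogeneous_X K _).mul (MvPolynomial.isHomogeneous_X K _))

variable (K) in
theorem isReducedGroebnerBasis_iff_indispensable [Finite L] {ord : MonomialOrder L}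
    (hord : IsRankLex ord) :
    IsReducedGroebnerBasis ord (hibiIdeal L K) (monicHibiRelations L K) ↔
      (∀ a b : L, ¬ a ≤ b → ¬ b ≤ a → IsIndispensable (hibiIdeal L K) (hibiRelation K a b)) ∧
        ∃ G : Set (MvPolynomial L K), IsReducedGroebnerBasis ord (hibiIdeal L K) G ∧
          ∀ f ∈ G, f.IsHomogeneous 2 := by
  constructor
  · intro h
    have hL := ((isReducedGroebnerBasis_iff hord).1 h).1
    refine ⟨fun a b => isIndispensable_of_isConditionallyURC hL, _, h, ?_⟩
    rintro _ ⟨a, b, -, -, rfl⟩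
    exact (isHomogeneous_hibiRelation a b).neg
  · rintro ⟨hind, G, hG, hG2⟩
    have hL := isConditionallyURC_of_isIndispensable hind
    exact (isReducedGroebnerBasis_iff hord).2 ⟨hL, hasReductions_of_homogeneous hord hL hG hG2⟩

end Indispensable

/-! ### Consecutive complemented intervals -/

section Necessity

variable {L : Type*} [Lattice L]

theorem isComplementedInterval_of_mem {x y g h c : L} (hxy : ¬ x ≤ y) (hyx : ¬ y ≤ x)
    (hgh : ¬ g ≤ h) (hhg : ¬ h ≤ g) (hgc : g < c) (hhc : h < c)
    (hi : x ⊓ y ∈ ({g, h, c} : Multiset L)) (hs : x ⊔ y ∈ ({g, h, c} : Multiset L)) :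
    IsComplementedInterval g c ∨ IsComplementedInterval h c := by
  have hlt : x ⊓ y < x ⊔ y := inf_lt_sup.2 fun he => hxy he.le
  simp only [Multiset.insert_eq_cons, Multiset.mem_cons, Multiset.mem_singleton] at hi hs
  rcases hi with hi | hi | hi <;> rcases hs with hs | hs | hs <;> rw [hi, hs] at hlt
  · exact absurd hlt (lt_irrefl _)
  · exact absurd hlt.le hgh
  · exact .inl ⟨x, y, isComplementarySet_iff.2 ⟨hxy, hyx, hi, hs⟩⟩
  · exact absurd hlt.le hhg
  · exact absurd hlt (lt_irrefl _)
  · exact .inr ⟨x, y, isComplementarySet_iff.2 ⟨hxy, hyx, hi, hs⟩⟩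
  · exact absurd hlt hgc.asymm
  · exact absurd hlt hhc.asymm
  · exact absurd hlt (lt_irrefl _)

theorem eq_of_hibiStep_triple {g h c : L} (hgc : g < c) (hhc : h < c) {W : Multiset L}
    (hW : HibiStep W {g, h, c}) : W = {g ⊓ h, g ⊔ h, c} := by
  obtain ⟨x, y, R, hxy, hyx, rfl, hM⟩ := hW
  have hx : x ∈ ({g, h, c} : Multiset L) := hM ▸ by simp
  have hy : y ∈ ({g, h, c} : Multiset L) := hM ▸ by simp
  simp only [Multiset.insert_eq_cons, Multiset.mem_cons, Multiset.mem_singleton] at hx hy hM ⊢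
  rcases hx with rfl | rfl | rfl <;> rcases hy with rfl | rfl | rfl
  · exact absurd le_rfl hxy
  · rw [Multiset.cons_inj_right, Multiset.cons_inj_right] at hM
    rw [← hM]
  · exact absurd hgc.le hxy
  · rw [Multiset.cons_swap, Multiset.cons_inj_right, Multiset.cons_inj_right] at hM
    rw [← hM, inf_comm, sup_comm]
  · exact absurd le_rfl hxy
  · exact absurd hhc.le hxy
  · exact absurd hgc.le hyx
  · exact absurd hhc.le hyx
  · exact absurd le_rfl hxy

/-- If neither `[g, c]` nor `[h, c]` is complemented, then `z_g z_h z_c` is irreducible, hence the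
smallest monomial of its class. The second smallest monomial `W` of the class can be rewritten, and
only to `z_g z_h z_c`, so it is `z_a z_b z_c`. But `z_a z_p z_q`, for a complementary set `{p, q}`
of `[b, c]`, is in the class and smaller than `z_a z_b z_c`. -/
theorem isComplementedInterval_of_hasReductions [Finite L] {ord : MonomialOrder L}
    (hord : IsRankLex ord) (hred : HasReductions ord) {a b c g h : L} (hbc : b < c)
    (hc : IsComplementedInterval b c) (hgh : IsComplementarySet a b g h) :
    IsComplementedInterval g c ∨ IsComplementedInterval h c := by
  obtain ⟨p, q, hpq⟩ := hc
  rw [isComplementarySet_iff] at hgh hpq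
  obtain ⟨hgh, hhg, rfl, rfl⟩ := hgh
  obtain ⟨hpq, hqp, hpqi, rfl⟩ := hpq
  by_contra! hcon
  have hgb : g ≤ g ⊔ h := le_sup_left
  have hhb : h ≤ g ⊔ h := le_sup_right
  have hgc : g < p ⊔ q := hgb.trans_lt hbc
  have hhc : h < p ⊔ q := hhb.trans_lt hbc
  have hirr : ∀ M, ¬ HibiStep {g, h, p ⊔ q} M := by
    rintro _ ⟨x, y, R, hxy, hyx, hM, -⟩
    have := isComplementedInterval_of_mem hxy hyx hgh hhg hgc hhc (hM ▸ by simp) (hM ▸ by simp)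
    tauto
  have hstep₁ : HibiStep {g ⊓ h, g ⊔ h, p ⊔ q} {g, h, p ⊔ q} := ⟨g, h, {p ⊔ q}, hgh, hhg, rfl, rfl⟩
  have hstep₂ : HibiStep {g ⊓ h, g ⊔ h, p ⊔ q} {p, q, g ⊓ h} :=
    ⟨p, q, {g ⊓ h}, hpq, hqp, by
      rw [hpqi]; simp only [Multiset.insert_eq_cons, ← Multiset.singleton_add]; abel, rfl⟩
  -- The class without its smallest element.
  let S : Set (Multiset L) := {M | Relation.EqvGen HibiStep {g, h, p ⊔ q} M ∧ M ≠ {g, h, p ⊔ q}}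
  have hS : ({p, q, g ⊓ h} : Multiset L) ∈ S := by
    refine ⟨.trans _ _ _ (.symm _ _ (.rel _ _ hstep₁)) (.rel _ _ hstep₂), fun he => ?_⟩
    have hmem : g ⊓ h ∈ ({g, h, p ⊔ q} : Multiset L) := he ▸ by simp
    simp only [Multiset.insert_eq_cons, Multiset.mem_cons, Multiset.mem_singleton, inf_eq_left,
      inf_eq_right] at hmem
    rcases hmem with h₁ | h₁ | h₁
    · exact hgh h₁
    · exact hhg h₁
    · exact (inf_le_left.trans_lt hgc).ne h₁
  obtain ⟨W, ⟨hWc, hWne⟩, hWmin⟩ := WellFounded.has_min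
    (InvImage.wf (fun M => ord.toSyn (expo M)) wellFounded_lt) S ⟨_, hS⟩
  have hlt : expo {g, h, p ⊔ q} ≺[ord] expo W := by
    rcases lt_trichotomy (ord.toSyn (expo {g, h, p ⊔ q})) (ord.toSyn (expo W)) with h₁ | h₁ | h₁
    · exact h₁
    · exact absurd (expo.injective (ord.toSyn.injective h₁)).symm hWne
    · obtain ⟨P, hP⟩ := hred _ _ hWc h₁
      exact absurd hP (hirr P)
  obtain ⟨P, hP⟩ := hred _ _ (.symm _ _ hWc) hlt
  have hPeq : P = {g, h, p ⊔ q} := by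
    by_contra hPne
    exact hWmin P ⟨.trans _ _ _ hWc (.rel _ _ hP), hPne⟩ (expo_lt_of_hibiStep hord hP)
  subst hPeq
  obtain rfl := eq_of_hibiStep_triple hgc hhc hP
  exact hWmin _ hS (expo_lt_of_hibiStep hord hstep₂)

end Necessity

/-! ### Confluence in a planar lattice -/

section Grid

variable {L : Type*} [Lattice L]

/-- `X` and `Y` are coordinates of `L`: together they embed `L` as a sublattice of `ℤ × ℤ`. -/
structure IsGrid (X Y : L → ℤ) : Prop where
  inj : ∀ a b, X a = X b → Y a = Y b → a = b
  X_sup : ∀ a b, X (a ⊔ b) = max (X a) (X b)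
  X_inf : ∀ a b, X (a ⊓ b) = min (X a) (X b)
  Y_sup : ∀ a b, Y (a ⊔ b) = max (Y a) (Y b)
  Y_inf : ∀ a b, Y (a ⊓ b) = min (Y a) (Y b)

/-- `e`, `f` are the lower left and upper right corner of a nondegenerate rectangle, whose upper
left and lower right corner are `c` and `d`. -/
def IsBlock (X Y : L → ℤ) (e f c d : L) : Prop :=
  X e < X f ∧ Y e < Y f ∧ X c = X e ∧ Y c = Y f ∧ X d = X f ∧ Y d = Y e

variable {X Y : L → ℤ}

theorem IsGrid.le_iff (h : IsGrid X Y) {a b : L} : a ≤ b ↔ X a ≤ X b ∧ Y a ≤ Y b := by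
  have h₁ := h.X_inf a b
  have h₂ := h.Y_inf a b
  constructor
  · intro hab
    rw [inf_eq_left.2 hab] at h₁ h₂
    omega
  · rintro ⟨hX, hY⟩
    exact inf_eq_left.1 (h.inj _ _ (by omega) (by omega))

theorem IsBlock.spec (h : IsGrid X Y) {e f c d : L} (hb : IsBlock X Y e f c d) :
    ¬ c ≤ d ∧ ¬ d ≤ c ∧ c ⊓ d = e ∧ c ⊔ d = f := by
  obtain ⟨h₁, h₂, h₃, h₄, h₅, h₆⟩ := hb
  have h₇ := h.X_inf c d
  have h₈ := h.Y_inf c d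
  have h₉ := h.X_sup c d
  have h₁₀ := h.Y_sup c d
  rw [h.le_iff, h.le_iff]
  exact ⟨by omega, by omega, h.inj _ _ (by omega) (by omega), h.inj _ _ (by omega) (by omega)⟩

theorem IsGrid.isBlock_or (h : IsGrid X Y) {a b : L} (hab : ¬ a ≤ b) (hba : ¬ b ≤ a) :
    IsBlock X Y (a ⊓ b) (a ⊔ b) a b ∨ IsBlock X Y (a ⊓ b) (a ⊔ b) b a := by
  have h₇ := h.X_inf a b
  have h₈ := h.Y_inf a b
  have h₉ := h.X_sup a b
  have h₁₀ := h.Y_sup a b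
  rw [h.le_iff] at hab hba
  unfold IsBlock
  omega

theorem IsBlock.hibiStep (h : IsGrid X Y) {e f c d : L} (hb : IsBlock X Y e f c d)
    {M N : Multiset L} (R : Multiset L) (hM : M = e ::ₘ f ::ₘ R) (hN : N = c ::ₘ d ::ₘ R) :
    HibiStep M N := by
  obtain ⟨h₁, h₂, rfl, rfl⟩ := hb.spec h
  exact ⟨c, d, R, h₁, h₂, hM, hN⟩

theorem IsGrid.exists_isBlock (h : IsGrid X Y) {M N : Multiset L} (hMN : HibiStep M N) :
    ∃ e f c d R, IsBlock X Y e f c d ∧ M = e ::ₘ f ::ₘ R ∧ N = c ::ₘ d ::ₘ R := by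
  obtain ⟨a, b, R, hab, hba, rfl, rfl⟩ := hMN
  rcases h.isBlock_or hab hba with hb | hb
  · exact ⟨_, _, a, b, R, hb, rfl, rfl⟩
  · exact ⟨_, _, b, a, R, hb, rfl, Multiset.cons_swap _ _ _⟩

theorem IsGrid.isComplementedInterval_iff (h : IsGrid X Y) {e f : L} :
    IsComplementedInterval e f ↔ ∃ c d, IsBlock X Y e f c d := by
  constructor
  · rintro ⟨c, d, hcd⟩
    obtain ⟨h₁, h₂, rfl, rfl⟩ := isComplementarySet_iff.1 hcd
    rcases h.isBlock_or h₁ h₂ with hb | hb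
    · exact ⟨_, _, hb⟩
    · exact ⟨_, _, hb⟩
  · rintro ⟨c, d, hcd⟩
    exact ⟨c, d, isComplementarySet_iff.2 (hcd.spec h)⟩

theorem IsGrid.isConditionallyURC (h : IsGrid X Y) : IsConditionallyURC L := by
  rw [isConditionallyURC_iff]
  intro c d c' d' hcd hdc hcd' hdc' hi hs
  have h₁ := h.isBlock_or hcd hdc
  have h₂ := h.isBlock_or hcd' hdc'
  rw [← hi, ← hs] at h₂
  rw [pair_eq_pair_iff]
  unfold IsBlock at h₁ h₂
  rcases h₁ with h₁ | h₁ <;> rcases h₂ with h₂ | h₂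
  · exact .inl ⟨h.inj _ _ (by omega) (by omega), h.inj _ _ (by omega) (by omega)⟩
  · exact .inr ⟨h.inj _ _ (by omega) (by omega), h.inj _ _ (by omega) (by omega)⟩
  · exact .inr ⟨h.inj _ _ (by omega) (by omega), h.inj _ _ (by omega) (by omega)⟩
  · exact .inl ⟨h.inj _ _ (by omega) (by omega), h.inj _ _ (by omega) (by omega)⟩

/-- Two rectangles of the grid that share a vertex, being the upper right one of the former and
the lower left one of the latter, have one of the two remaining vertices of their common hull
in the grid. -/
def HasHullVertices (X Y : L → ℤ) : Prop :=
  ∀ a b c g h p q : L, IsBlock X Y a b g h → IsBlock X Y b c p q →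
    (∃ x, X x = X a ∧ Y x = Y c) ∨ ∃ x, X x = X c ∧ Y x = Y a

/-- The condition on consecutive complemented intervals, expressed in coordinates. -/
theorem IsGrid.hasHullVertices_iff (h : IsGrid X Y) :
    HasHullVertices X Y ↔ ∀ a b c : L, a < b → b < c → IsComplementedInterval b c →
      ∀ g h : L, IsComplementarySet a b g h →
        IsComplementedInterval g c ∨ IsComplementedInterval h c := by
  simp only [isComplementarySet_iff, h.isComplementedInterval_iff]
  constructor
  · rintro H a b c - - ⟨p, q, hpq⟩ g k ⟨hgk, hkg, rfl, rfl⟩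
    have aux : ∀ g k, IsBlock X Y (g ⊓ k) (g ⊔ k) g k → IsBlock X Y (g ⊔ k) c p q →
        (∃ x y, IsBlock X Y g c x y) ∨ ∃ x y, IsBlock X Y k c x y := by
      intro g k hb hpq
      rcases H _ _ _ _ _ _ _ hb hpq with ⟨x, hx⟩ | ⟨x, hx⟩
      · left
        refine ⟨x, q, ?_⟩
        unfold IsBlock at *
        omega
      · right
        refine ⟨p, x, ?_⟩
        unfold IsBlock at *
        omega
    rcases h.isBlock_or hgk hkg with hb | hb
    · exact aux g k hb hpq
    · exact (aux k g (by rwa [inf_comm, sup_comm]) (by rwa [sup_comm])).symm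
  · intro H a b c g k p q hab hbc
    have hab' : a < b := lt_of_le_not_ge (h.le_iff.2 (by unfold IsBlock at hab; omega))
      (fun hba => by rw [h.le_iff] at hba; unfold IsBlock at hab; omega)
    have hbc' : b < c := lt_of_le_not_ge (h.le_iff.2 (by unfold IsBlock at hbc; omega))
      (fun hba => by rw [h.le_iff] at hba; unfold IsBlock at hbc; omega)
    rcases H a b c hab' hbc' ⟨p, q, hbc⟩ g k (hab.spec h) with ⟨x, y, hb⟩ | ⟨x, y, hb⟩
    · left
      refine ⟨x, ?_⟩
      unfold IsBlock at *
      omega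
    · right
      refine ⟨y, ?_⟩
      unfold IsBlock at *
      omega

theorem IsGrid.exists_sup (h : IsGrid X Y) (a b : L) :
    ∃ x, X x = max (X a) (X b) ∧ Y x = max (Y a) (Y b) :=
  ⟨a ⊔ b, h.X_sup a b, h.Y_sup a b⟩

theorem IsGrid.exists_inf (h : IsGrid X Y) (a b : L) :
    ∃ x, X x = min (X a) (X b) ∧ Y x = min (Y a) (Y b) :=
  ⟨a ⊓ b, h.X_inf a b, h.Y_inf a b⟩

open Relation

/-- Local confluence for two rectangles with the same lower left corner: all vertices of the
`3 × 3` grid spanned by them are in the lattice. -/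
theorem IsGrid.join_of_same_bottom (h : IsGrid X Y) {e f f' c d c' d' : L} (S : Multiset L)
    (hb : IsBlock X Y e f c d) (hb' : IsBlock X Y e f' c' d') :
    Join (ReflTransGen HibiStep) (c ::ₘ d ::ₘ f' ::ₘ S) (c' ::ₘ d' ::ₘ f ::ₘ S) := by
  wlog hle : X f < X f' ∨ X f = X f' ∧ Y f ≤ Y f' generalizing f f' c d c' d'
  · obtain ⟨P, h₁, h₂⟩ := this hb' hb (by omega)
    exact ⟨P, h₂, h₁⟩
  obtain ⟨u, hu⟩ := h.exists_sup d c'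
  obtain ⟨v, hv⟩ := h.exists_sup d' c
  unfold IsBlock at hb hb'
  rcases hle with hX | ⟨hX, hY⟩
  · rcases lt_trichotomy (Y f) (Y f') with hY | hY | hY
    · refine ⟨_, .head (b := c' ::ₘ v ::ₘ d ::ₘ S) ?_ (.single ?_), .refl⟩
      · refine IsBlock.hibiStep h (e := c) (f := f') (c := c') (d := v) ?_ (d ::ₘ S) ?_ ?_
        · unfold IsBlock; omega
        all_goals simp only [← Multiset.singleton_add]
        all_goals abel
      · refine IsBlock.hibiStep h (e := d) (f := v) (c := f) (d := d') ?_ (c' ::ₘ S) ?_ ?_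
        · unfold IsBlock; omega
        all_goals simp only [← Multiset.singleton_add]
        all_goals abel
    · obtain rfl : c = c' := h.inj _ _ (by omega) (by omega)
      refine ⟨_, .single ?_, .refl⟩
      refine IsBlock.hibiStep h (e := d) (f := f') (c := f) (d := d') ?_ (c ::ₘ S) ?_ ?_
      · unfold IsBlock; omega
      all_goals simp only [← Multiset.singleton_add]
      all_goals abel
    · refine ⟨c ::ₘ u ::ₘ d' ::ₘ S, .single ?_, .single ?_⟩
      · refine IsBlock.hibiStep h (e := d) (f := f') (c := u) (d := d') ?_ (c ::ₘ S) ?_ ?_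
        · unfold IsBlock; omega
        all_goals simp only [← Multiset.singleton_add]
        all_goals abel
      · refine IsBlock.hibiStep h (e := c') (f := f) (c := c) (d := u) ?_ (d' ::ₘ S) ?_ ?_
        · unfold IsBlock; omega
        all_goals simp only [← Multiset.singleton_add]
        all_goals abel
  · obtain rfl : d = d' := h.inj _ _ (by omega) (by omega)
    rcases hY.lt_or_eq with hY | hY
    · refine ⟨_, .single ?_, .refl⟩
      refine IsBlock.hibiStep h (e := c) (f := f') (c := c') (d := f) ?_ (d ::ₘ S) ?_ ?_
      · unfold IsBlock; omega
      all_goals simp only [← Multiset.singleton_add]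
      all_goals abel
    · obtain rfl : f = f' := h.inj _ _ (by omega) (by omega)
      obtain rfl : c = c' := h.inj _ _ (by omega) (by omega)
      exact ⟨_, .refl, .refl⟩

/-- Local confluence for two rectangles with the same upper right corner. -/
theorem IsGrid.join_of_same_top (h : IsGrid X Y) {e e' f c d c' d' : L} (S : Multiset L)
    (hb : IsBlock X Y e f c d) (hb' : IsBlock X Y e' f c' d') :
    Join (ReflTransGen HibiStep) (c ::ₘ d ::ₘ e' ::ₘ S) (c' ::ₘ d' ::ₘ e ::ₘ S) := by
  wlog hle : X e' < X e ∨ X e' = X e ∧ Y e' ≤ Y e generalizing e e' c d c' d'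
  · obtain ⟨P, h₁, h₂⟩ := this hb' hb (by omega)
    exact ⟨P, h₂, h₁⟩
  obtain ⟨u, hu⟩ := h.exists_inf c d'
  obtain ⟨v, hv⟩ := h.exists_inf c' d
  unfold IsBlock at hb hb'
  rcases hle with hX | ⟨hX, hY⟩
  · rcases lt_trichotomy (Y e') (Y e) with hY | hY | hY
    · refine ⟨_, .head (b := d' ::ₘ v ::ₘ c ::ₘ S) ?_ (.single ?_), .refl⟩
      · refine IsBlock.hibiStep h (e := e') (f := d) (c := v) (d := d') ?_ (c ::ₘ S) ?_ ?_
        · unfold IsBlock; omega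
        all_goals simp only [← Multiset.singleton_add]
        all_goals abel
      · refine IsBlock.hibiStep h (e := v) (f := c) (c := c') (d := e) ?_ (d' ::ₘ S) ?_ ?_
        · unfold IsBlock; omega
        all_goals simp only [← Multiset.singleton_add]
        all_goals abel
    · obtain rfl : d = d' := h.inj _ _ (by omega) (by omega)
      refine ⟨_, .single ?_, .refl⟩
      refine IsBlock.hibiStep h (e := e') (f := c) (c := c') (d := e) ?_ (d ::ₘ S) ?_ ?_
      · unfold IsBlock; omega
      all_goals simp only [← Multiset.singleton_add]
      all_goals abel
    · refine ⟨c' ::ₘ u ::ₘ d ::ₘ S, .single ?_, .single ?_⟩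
      · refine IsBlock.hibiStep h (e := e') (f := c) (c := c') (d := u) ?_ (d ::ₘ S) ?_ ?_
        · unfold IsBlock; omega
        all_goals simp only [← Multiset.singleton_add]
        all_goals abel
      · refine IsBlock.hibiStep h (e := e) (f := d') (c := u) (d := d) ?_ (c' ::ₘ S) ?_ ?_
        · unfold IsBlock; omega
        all_goals simp only [← Multiset.singleton_add]
        all_goals abel
  · obtain rfl : c = c' := h.inj _ _ (by omega) (by omega)
    rcases hY.lt_or_eq with hY | hY
    · refine ⟨_, .single ?_, .refl⟩
      refine IsBlock.hibiStep h (e := e') (f := d) (c := e) (d := d') ?_ (c ::ₘ S) ?_ ?_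
      · unfold IsBlock; omega
      all_goals simp only [← Multiset.singleton_add]
      all_goals abel
    · obtain rfl : e = e' := h.inj _ _ (by omega) (by omega)
      obtain rfl : d = d' := h.inj _ _ (by omega) (by omega)
      exact ⟨_, .refl, .refl⟩

/-- Local confluence for two rectangles that meet in a vertex. This is where a missing vertex of
the common hull would obstruct confluence. -/
theorem IsGrid.join_of_chain (h : IsGrid X Y) (H : HasHullVertices X Y) {e f g c d p q : L}
    (S : Multiset L) (hb : IsBlock X Y e f c d) (hb' : IsBlock X Y f g p q) :
    Join (ReflTransGen HibiStep) (c ::ₘ d ::ₘ g ::ₘ S) (p ::ₘ q ::ₘ e ::ₘ S) := by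
  have H' := H _ _ _ _ _ _ _ hb hb'
  unfold IsBlock at hb hb'
  rcases H' with ⟨x, hx⟩ | ⟨x, hx⟩
  · refine ⟨x ::ₘ q ::ₘ d ::ₘ S, .single ?_, .single ?_⟩
    · refine IsBlock.hibiStep h (e := c) (f := g) (c := x) (d := q) ?_ (d ::ₘ S) ?_ ?_
      · unfold IsBlock; omega
      all_goals simp only [← Multiset.singleton_add]
      all_goals abel
    · refine IsBlock.hibiStep h (e := e) (f := p) (c := x) (d := d) ?_ (q ::ₘ S) ?_ ?_
      · unfold IsBlock; omega
      all_goals simp only [← Multiset.singleton_add]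
      all_goals abel
  · refine ⟨x ::ₘ c ::ₘ p ::ₘ S, .single ?_, .single ?_⟩
    · refine IsBlock.hibiStep h (e := d) (f := g) (c := p) (d := x) ?_ (c ::ₘ S) ?_ ?_
      · unfold IsBlock; omega
      all_goals simp only [← Multiset.singleton_add]
      all_goals abel
    · refine IsBlock.hibiStep h (e := e) (f := q) (c := c) (d := x) ?_ (p ::ₘ S) ?_ ?_
      · unfold IsBlock; omega
      all_goals simp only [← Multiset.singleton_add]
      all_goals abel

/-- Steps at disjoint pairs of factors commute; otherwise the two rectangles share a vertex. -/
theorem IsGrid.locallyConfluent (h : IsGrid X Y) (H : HasHullVertices X Y) (M N N' : Multiset L)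
    (hN : HibiStep M N) (hN' : HibiStep M N') : Join (ReflTransGen HibiStep) N N' := by
  obtain ⟨e, f, c, d, R, hb, rfl, rfl⟩ := h.exists_isBlock hN
  obtain ⟨e', f', c', d', R', hb', hM, rfl⟩ := h.exists_isBlock hN'
  rcases Multiset.cons_eq_cons.1 hM with ⟨rfl, hR⟩ | ⟨-, S, h₁, h₂⟩
  · rcases Multiset.cons_eq_cons.1 hR with ⟨rfl, rfl⟩ | ⟨-, S, rfl, rfl⟩
    · unfold IsBlock at hb hb'
      obtain rfl : c = c' := h.inj _ _ (by omega) (by omega)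
      obtain rfl : d = d' := h.inj _ _ (by omega) (by omega)
      exact ⟨_, .refl, .refl⟩
    · exact h.join_of_same_bottom S hb hb'
  rcases Multiset.cons_eq_cons.1 h₁ with ⟨rfl, rfl⟩ | ⟨-, T, rfl, rfl⟩
  · rcases Multiset.cons_eq_cons.1 h₂ with ⟨rfl, rfl⟩ | ⟨-, T, rfl, rfl⟩
    · unfold IsBlock at hb hb'
      omega
    · exact h.join_of_chain H T hb hb'
  · rcases Multiset.cons_eq_cons.1 h₂ with ⟨rfl, rfl⟩ | ⟨-, U, rfl, hU⟩
    · obtain ⟨P, h₁, h₂⟩ := h.join_of_chain H T hb' hb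
      exact ⟨P, h₂, h₁⟩
    · rcases Multiset.cons_eq_cons.1 hU with ⟨rfl, rfl⟩ | ⟨-, V, rfl, rfl⟩
      · exact h.join_of_same_top T hb hb'
      · refine ⟨c ::ₘ d ::ₘ c' ::ₘ d' ::ₘ V, .single ?_, .single ?_⟩
        · refine hb'.hibiStep h (c ::ₘ d ::ₘ V) ?_ ?_
          all_goals simp only [← Multiset.singleton_add]
          all_goals abel
        · refine hb.hibiStep h (c' ::ₘ d' ::ₘ V) ?_ ?_
          all_goals simp only [← Multiset.singleton_add]
          all_goals abel

/-- In a confluent system a monomial `M` equivalent to `N` rewrites to a common descendant with `N`;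
if `M` were irreducible, this descendant would be `M`, and `M` would not be larger than `N`. -/
theorem IsGrid.hasReductions [Finite L] (h : IsGrid X Y) (H : HasHullVertices X Y)
    {ord : MonomialOrder L} (hord : IsRankLex ord) : HasReductions ord := by
  intro M N hMN hlt
  obtain ⟨P, hMP, hNP⟩ := join_of_eqvGen (wellFounded_hibiStep hord) (h.locallyConfluent H) hMN
  rcases hMP.cases_head with rfl | ⟨Q, hQ, -⟩
  · have hle : ord.toSyn (expo M) ≤ ord.toSyn (expo N) := by
      clear hlt hMP hMN
      induction hNP using ReflTransGen.head_induction_on with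
      | refl => exact le_rfl
      | head hstep _ ih => exact ih.trans (expo_lt_of_hibiStep hord hstep).le
    exact absurd hlt hle.not_gt
  · exact ⟨Q, hQ⟩

end Grid

/-! ### Corners of planar regions -/

section Regions

/-- A sublattice of `ℤ × ℤ`, given by its membership predicate, that meets each horizontal and
each vertical line in an interval. -/
structure IsRegion (P : ℤ → ℤ → Prop) : Prop where
  sup : ∀ {i j i' j'}, P i j → P i' j' → P (max i i') (max j j')
  inf : ∀ {i j i' j'}, P i j → P i' j' → P (min i i') (min j j')
  row : ∀ {i i' j k}, P i j → P i' j → i ≤ k → k ≤ i' → P k j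
  col : ∀ {i j j' k}, P i j → P i j' → j ≤ k → k ≤ j' → P i k

variable {P : ℤ → ℤ → Prop}

theorem IsRegion.swap (h : IsRegion P) : IsRegion fun i j => P j i where
  sup h₁ h₂ := h.sup h₁ h₂
  inf h₁ h₂ := h.inf h₁ h₂
  row h₁ h₂ := h.col h₁ h₂
  col h₁ h₂ := h.row h₁ h₂

theorem IsRegion.rect (h : IsRegion P) {i j i' j' k l : ℤ} (h₁ : P i j) (h₂ : P i j')
    (h₃ : P i' j) (h₄ : P i' j') (hik : i ≤ k) (hki : k ≤ i') (hjl : j ≤ l) (hlj : l ≤ j') :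
    P k l :=
  h.row (h.col h₁ h₂ hjl hlj) (h.col h₃ h₄ hjl hlj) hik hki

/-- `(i, j)` is an upper or a critical corner. -/
def IsUpper (P : ℤ → ℤ → Prop) (i j : ℤ) : Prop :=
  P i j ∧ P (i - 1) j ∧ P (i + 1) j ∧ P i (j + 1) ∧ P i (j - 1) ∧ ¬ P (i - 1) (j + 1)

/-- `(i, j)` is a lower or a critical corner. -/
def IsLower (P : ℤ → ℤ → Prop) (i j : ℤ) : Prop :=
  P i j ∧ P (i - 1) j ∧ P (i + 1) j ∧ P i (j + 1) ∧ P i (j - 1) ∧ ¬ P (i + 1) (j - 1)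

theorem isUpper_swap {i j : ℤ} : IsUpper (fun i j => P j i) i j ↔ IsLower P j i := by
  unfold IsUpper IsLower
  tauto

/-- Whenever the rectangles `[a, b]` and `[b, c]` are contained in the region, so is one of the two
other vertices of the rectangle `[a, c]`. -/
def HasHulls (P : ℤ → ℤ → Prop) : Prop :=
  ∀ a₁ a₂ b₁ b₂ c₁ c₂ : ℤ, a₁ < b₁ → b₁ < c₁ → a₂ < b₂ → b₂ < c₂ → P a₁ a₂ → P a₁ b₂ → P b₁ a₂ →
    P b₁ b₂ → P b₁ c₂ → P c₁ b₂ → P c₁ c₂ → P a₁ c₂ ∨ P c₁ a₂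

theorem exists_last_int {Q : ℤ → Prop} {a b : ℤ} (hab : a ≤ b) (ha : Q a) (hb : ¬ Q b) :
    ∃ k, a ≤ k ∧ k < b ∧ Q k ∧ ¬ Q (k + 1) := by
  by_contra! hcon
  have : ∀ k, a ≤ k → k ≤ b → Q k := by
    intro k hk
    induction k, hk using Int.leInduction with
    | base => exact fun _ => ha
    | succ k hk ih => exact fun hkb => hcon k hk (by omega) (ih (by omega))
  exact hb (this b hab le_rfl)

/-- If the upper left vertex of the hull of `[a, b]` and `[b, c]` is missing, then the boundary
of the region turns at a corner to the upper left of `b`. -/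
theorem IsRegion.exists_isUpper (h : IsRegion P) {a₁ a₂ b₁ b₂ c₁ c₂ : ℤ} (h₁ : a₁ < b₁)
    (h₂ : b₁ < c₁) (h₃ : a₂ < b₂) (h₄ : b₂ < c₂) (h₅ : P a₁ a₂) (h₆ : P a₁ b₂) (h₇ : P b₁ a₂)
    (h₈ : P b₁ b₂) (h₉ : P b₁ c₂) (h₁₀ : P c₁ b₂) (h₁₁ : P c₁ c₂) (hn : ¬ P a₁ c₂) :
    ∃ i j, i ≤ b₁ ∧ b₂ ≤ j ∧ IsUpper P i j := by
  -- Go up from `(a₁, b₂)` as far as possible, then right along the first row that is missed.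
  obtain ⟨j, hj₁, hj₂, hj₃, hj₄⟩ := exists_last_int h₄.le h₆ hn
  have hbj : ∀ l, b₂ ≤ l → l ≤ c₂ → P b₁ l := fun l => h.col h₈ h₉
  obtain ⟨k, hk₁, hk₂, hk₃, hk₄⟩ := exists_last_int (Q := fun i => ¬ P i (j + 1)) h₁.le hj₄
    (not_not.2 (hbj (j + 1) (by omega) (by omega)))
  have hup : ∀ i l, a₁ ≤ i → i ≤ b₁ → b₂ ≤ l → l ≤ j → P i l := fun i l =>
    h.rect h₆ hj₃ h₈ (hbj j hj₁ (by omega))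
  refine ⟨k + 1, j, by omega, hj₁, hup _ _ (by omega) (by omega) hj₁ le_rfl, ?_, ?_,
    not_not.1 hk₄, ?_, ?_⟩
  · exact hup _ _ (by omega) (by omega) hj₁ le_rfl
  · rcases (show k + 1 ≤ b₁ by omega).lt_or_eq with hk | hk
    · exact hup _ _ (by omega) (by omega) hj₁ le_rfl
    · exact h.rect h₈ h₉ h₁₀ h₁₁ (by omega) (by omega) hj₁ (by omega)
  · rcases hj₁.lt_or_eq with hj | hj
    · exact hup _ _ (by omega) (by omega) (by omega) (by omega)
    · exact h.rect h₅ h₆ h₇ h₈ (by omega) (by omega) (by omega) (by omega)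
  · simpa using hk₃

/-- If both remaining vertices of a hull are absent, there are an upper corner weakly to the
upper left and a lower corner weakly to the lower right of `b`. -/
theorem IsRegion.hasHulls (h : IsRegion P)
    (hP : ∀ i j i' j', IsUpper P i j → IsLower P i' j' → i < i' ∧ j < j' ∨ i' < i ∧ j' < j) :
    HasHulls P := by
  intro a₁ a₂ b₁ b₂ c₁ c₂ h₁ h₂ h₃ h₄ h₅ h₆ h₇ h₈ h₉ h₁₀ h₁₁
  by_contra! hcon
  obtain ⟨i, j, hi, hj, hu⟩ := h.exists_isUpper h₁ h₂ h₃ h₄ h₅ h₆ h₇ h₈ h₉ h₁₀ h₁₁ hcon.1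
  obtain ⟨j', i', hj', hi', hl⟩ :=
    h.swap.exists_isUpper h₃ h₄ h₁ h₂ h₅ h₇ h₆ h₈ h₁₀ h₉ h₁₁ hcon.2
  have := hP i j i' j' hu (isUpper_swap.1 hl)
  omega

/-- Two upper corners are never incomparable, and never on a common row or column: otherwise the
upper left neighbour of one of them would belong to the region. -/
theorem IsRegion.isUpper_isUpper (h : IsRegion P) {i j i' j' : ℤ} (hu : IsUpper P i j)
    (hu' : IsUpper P i' j') (hne : i ≠ i' ∨ j ≠ j') : i < i' ∧ j < j' ∨ i' < i ∧ j' < j := by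
  wlog hle : i < i' ∨ i = i' ∧ j < j' generalizing i j i' j'
  · exact (this hu' hu (by omega) (by omega)).symm
  obtain ⟨h₁, h₂, h₃, h₄, h₅, h₆⟩ := hu
  obtain ⟨h₁', h₂', h₃', h₄', h₅', h₆'⟩ := hu'
  rcases hle with hi | ⟨rfl, hj⟩
  · by_contra! hcon
    have hj : j' ≤ j := by omega
    have hi₁ : P i j' := by simpa [min_eq_left hi.le, min_eq_right hj] using h.inf h₁ h₁'
    have hi₂ : P i' j := by simpa [max_eq_right hi.le, max_eq_left hj] using h.sup h₁ h₁'
    rcases hj.lt_or_eq with hj | rfl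
    · exact h₆' (h.rect hi₁ h₁ h₁' hi₂ (by omega) (by omega) (by omega) (by omega))
    · exact h₆' (h.row h₄ h₄' (by omega) (by omega))
  · exact absurd (h.col h₂ h₂' (by omega) (by omega)) h₆

/-- If an upper corner is weakly to the upper left of a lower corner, the rectangles around the
former contradict the hull condition. If it is weakly to the lower right, then its upper left
neighbour belongs to the region by convexity. -/
theorem IsRegion.isUpper_isLower (h : IsRegion P) (H : HasHulls P) {i j i' j' : ℤ}
    (hu : IsUpper P i j) (hl : IsLower P i' j') : i < i' ∧ j < j' ∨ i' < i ∧ j' < j := by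
  obtain ⟨h₁, h₂, h₃, h₄, h₅, h₆⟩ := hu
  obtain ⟨h₁', h₂', h₃', h₄', h₅', h₆'⟩ := hl
  by_cases hNW : i ≤ i' ∧ j' ≤ j
  -- The rectangles `[(i - 1, j' - 1), (i, j)]` and `[(i, j), (i' + 1, j + 1)]` contradict `H`.
  · obtain ⟨hi, hj⟩ := hNW
    have e₁ : P (i - 1) (j' - 1) := by
      have := h.inf h₂ h₅'
      rwa [min_eq_left (by omega), min_eq_right (by omega)] at this
    have e₂ : P i (j' - 1) := by
      have := h.inf h₁ h₅'
      rwa [min_eq_left (by omega), min_eq_right (by omega)] at this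
    have e₃ : P (i' + 1) j := by
      have := h.sup h₁ h₃'
      rwa [max_eq_right (by omega), max_eq_left (by omega)] at this
    have e₄ : P (i' + 1) (j + 1) := by
      have := h.sup h₄ h₃'
      rwa [max_eq_right (by omega), max_eq_left (by omega)] at this
    rcases H (i - 1) (j' - 1) i j (i' + 1) (j + 1) (by omega) (by omega) (by omega) (by omega)
      e₁ h₂ e₂ h₁ h₄ e₃ e₄ with e | e
    · exact absurd e h₆
    · exact absurd e h₆'
  by_contra! hcon
  have hi : i' ≤ i := by omega
  have hj : j ≤ j' := by omega
  rcases hi.lt_or_eq with hi | rfl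
  · rcases hj.lt_or_eq with hj | rfl
    · have e₁ : P i' j := by simpa [min_eq_right hi.le, min_eq_left hj.le] using h.inf h₁ h₁'
      have e₂ : P i j' := by simpa [max_eq_left hi.le, max_eq_right hj.le] using h.sup h₁ h₁'
      exact h₆ (h.rect e₁ h₁' h₁ e₂ (by omega) (by omega) (by omega) (by omega))
    · exact h₆ (h.row h₄' h₄ (by omega) (by omega))
  · exact h₆ (h.col h₂ h₂' (by omega) (by omega))

end Regions

/-! ### Full sublattices and chain ladders -/

section FullSublattices

variable {m n : ℕ} {D : Sublattice (ℤ × ℤ)}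

/-- The coordinates take all values in their range if there is a chain of length `m + n`:
if the level `k` of `Y` were missed, then contracting it would give a strictly monotone
function `X + Y - 1_{k < Y}` with too few values for a chain of length `m + n`. -/
theorem exists_eq_of_ltSeries {α : Type*} [Preorder α] {X Y : α → ℤ} (hX : Monotone X)
    (hY : Monotone Y) (hXY : ∀ a b, a < b → X a < X b ∨ Y a < Y b)
    (hbd : ∀ a, 0 ≤ X a ∧ 0 ≤ Y a ∧ X a ≤ m ∧ Y a ≤ n) {p : LTSeries α} (hp : p.length = m + n)
    {k : ℤ} (hk₀ : 0 ≤ k) (hkn : k ≤ n) : ∃ a, Y a = k := by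
  by_contra! hcon
  let f : α → ℤ := fun a => X a + Y a - if k < Y a then 1 else 0
  have hf : StrictMono f := by
    intro a b hab
    have h₁ := hcon a
    have h₂ := hcon b
    have h₃ := hX hab.le
    have h₄ := hY hab.le
    have h₅ := hXY a b hab
    simp only [f]
    split_ifs <;> omega
  have hmaps : ∀ i ∈ (Finset.univ : Finset (Fin (p.length + 1))),
      f (p i) ∈ Finset.Icc (0 : ℤ) (m + n - 1) := by
    intro i _
    have h₁ := hcon (p i)
    have h₂ := hbd (p i)
    simp only [f, Finset.mem_Icc]
    split_ifs <;> omega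
  have hcard := Finset.card_le_card_of_injOn _ hmaps (hf.comp p.strictMono).injective.injOn
  rw [Finset.card_univ, Fintype.card_fin, Int.card_Icc] at hcard
  omega

/-- Meets and joins with an element of an intermediate row fill the gap between two elements
of one column. -/
theorem IsFullSublattice.isRegion (hD : IsFullSublattice m n D) :
    IsRegion fun i j => (i, j) ∈ D := by
  have hsub := hD.1
  have hbd : ∀ {i j : ℤ}, (i, j) ∈ D → 0 ≤ i ∧ 0 ≤ j ∧ i ≤ m ∧ j ≤ n := by
    intro i j hij
    have := hsub hij
    rw [Set.mem_Icc, Prod.le_def, Prod.le_def] at this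
    exact ⟨this.1.1, this.1.2, this.2.1, this.2.2⟩
  have hsup : ∀ {i j i' j' : ℤ}, (i, j) ∈ D → (i', j') ∈ D → (max i i', max j j') ∈ D :=
    fun h₁ h₂ => D.supClosed h₁ h₂
  have hinf : ∀ {i j i' j' : ℤ}, (i, j) ∈ D → (i', j') ∈ D → (min i i', min j j') ∈ D :=
    fun h₁ h₂ => D.infClosed h₁ h₂
  have hX : Monotone fun x : D => x.1.1 := fun x y h => (Prod.le_def.1 h).1
  have hY : Monotone fun x : D => x.1.2 := fun x y h => (Prod.le_def.1 h).2
  have hXY : ∀ x y : D, x < y → x.1.1 < y.1.1 ∨ x.1.2 < y.1.2 := by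
    intro x y h
    by_contra! hcon
    exact h.not_ge (Prod.le_def.2 hcon)
  obtain ⟨p, hp⟩ := hD.2
  refine ⟨hsup, hinf, ?_, ?_⟩
  · intro i i' j k h₁ h₂ hik hki
    obtain ⟨⟨⟨k, l⟩, hl⟩, rfl⟩ := exists_eq_of_ltSeries (m := n) (n := m) (k := k) hY hX
      (fun x y h => (hXY x y h).symm)
      (fun x => ⟨(hbd x.2).2.1, (hbd x.2).1, (hbd x.2).2.2.2, (hbd x.2).2.2.1⟩)
      (hp.trans (add_comm m n))
      ((hbd h₁).1.trans hik) (hki.trans (hbd h₂).2.2.1)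
    rcases le_total l j with hlj | hlj
    · have := hsup h₁ hl
      rwa [max_eq_right hik, max_eq_left hlj] at this
    · have := hinf h₂ hl
      rwa [min_eq_right hki, min_eq_left hlj] at this
  · intro i j j' k h₁ h₂ hjk hkj
    obtain ⟨⟨⟨l, k⟩, hl⟩, rfl⟩ := exists_eq_of_ltSeries (k := k) hX hY hXY (fun x => hbd x.2) hp
      ((hbd h₁).2.1.trans hjk) (hkj.trans (hbd h₂).2.2.2)
    rcases le_total l i with hli | hli
    · have := hsup h₁ hl
      rwa [max_eq_left hli, max_eq_right hjk] at this
    · have := hinf h₂ hl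
      rwa [min_eq_left hli, min_eq_right hkj] at this

theorem isUpper_iff {p : ℤ × ℤ} : IsUpper (fun i j => (i, j) ∈ D) p.1 p.2 ↔
    IsUpperCorner D p ∨ IsCriticalCorner D p := by
  unfold IsUpper IsUpperCorner IsCriticalCorner HasFourNeighbours
  tauto

theorem isLower_iff {p : ℤ × ℤ} : IsLower (fun i j => (i, j) ∈ D) p.1 p.2 ↔
    IsLowerCorner D p ∨ IsCriticalCorner D p := by
  unfold IsLower IsLowerCorner IsCriticalCorner HasFourNeighbours
  tauto

/-- Chain ladders without critical corners are the full sublattices satisfying the hull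
condition. -/
theorem isChainLadder_and_iff : (IsChainLadder m n D ∧ ∀ p, ¬ IsCriticalCorner D p) ↔
    IsFullSublattice m n D ∧ HasHulls fun i j => (i, j) ∈ D := by
  constructor
  · rintro ⟨⟨hD, hchain, hne⟩, hcrit⟩
    refine ⟨hD, hD.isRegion.hasHulls fun i j i' j' hu hl => ?_⟩
    have hu' := (isUpper_iff (p := (i, j)).1 hu).resolve_right (hcrit _)
    have hl' := (isLower_iff (p := (i', j')).1 hl).resolve_right (hcrit _)
    have hpq : ((i, j) : ℤ × ℤ) ≠ (i', j') := by
      intro he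
      rw [he] at hu'
      exact hu'.2.1 hl'.2.1
    have h₁ := hne _ _ (.inl hu') (.inr (.inl hl')) hpq
    have h₂ := hchain (.inl hu') (.inr hl') hpq
    simp only [Prod.mk_le_mk] at h₁ h₂
    omega
  · rintro ⟨hD, H⟩
    have hR := hD.isRegion
    have key : ∀ p q : ℤ × ℤ, IsCorner D p → IsCorner D q → p ≠ q →
        p.1 < q.1 ∧ p.2 < q.2 ∨ q.1 < p.1 ∧ q.2 < p.2 := by
      have hcorner : ∀ p, IsCorner D p → IsUpper (fun i j => (i, j) ∈ D) p.1 p.2 ∨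
          IsLower (fun i j => (i, j) ∈ D) p.1 p.2 := by
        intro p hp
        rw [isUpper_iff, isLower_iff]
        unfold IsCorner at hp
        tauto
      intro p q hp hq hne
      have hne' : p.1 ≠ q.1 ∨ p.2 ≠ q.2 := by
        by_contra! hcon
        exact hne (Prod.ext hcon.1 hcon.2)
      rcases hcorner p hp with hp | hp <;> rcases hcorner q hq with hq | hq
      · exact hR.isUpper_isUpper hp hq hne'
      · exact hR.isUpper_isLower H hp hq
      · exact (hR.isUpper_isLower H hq hp).symm
      · have := hR.swap.isUpper_isUpper (isUpper_swap.2 hp) (isUpper_swap.2 hq) hne'.symm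
        omega
    refine ⟨⟨hD, ?_, ?_⟩, ?_⟩
    · intro p hp q hq hne
      have hc : ∀ {p}, (IsUpperCorner D p ∨ IsLowerCorner D p) → IsCorner D p := fun h =>
        h.elim .inl fun h => .inr (.inl h)
      rcases key p q (hc hp) (hc hq) hne with h | h
      · exact .inl (Prod.le_def.2 ⟨h.1.le, h.2.le⟩)
      · exact .inr (Prod.le_def.2 ⟨h.1.le, h.2.le⟩)
    · intro p q hp hq hne
      have := key p q hp hq hne
      omega
    · intro p hp
      have := hR.isUpper_isLower H (isUpper_iff.2 (.inr hp)) (isLower_iff.2 (.inr hp))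
      omega

variable {L : Type*} [Lattice L]

theorem isGrid_of_orderIso (e : L ≃o D) : IsGrid (fun a => (e a).1.1) fun a => (e a).1.2 where
  inj _ _ h₁ h₂ := e.injective (Subtype.ext (Prod.ext h₁ h₂))
  X_sup a b := by rw [map_sup]; rfl
  X_inf a b := by rw [map_inf]; rfl
  Y_sup a b := by rw [map_sup]; rfl
  Y_inf a b := by rw [map_inf]; rfl

theorem hasHullVertices_iff_of_orderIso (e : L ≃o D) :
    HasHullVertices (fun a => (e a).1.1) (fun a => (e a).1.2) ↔ HasHulls fun i j => (i, j) ∈ D := by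
  have hmem : ∀ i j : ℤ, (i, j) ∈ D ↔ ∃ x : L, (e x).1.1 = i ∧ (e x).1.2 = j := by
    intro i j
    constructor
    · intro h
      exact ⟨e.symm ⟨(i, j), h⟩, by simp, by simp⟩
    · rintro ⟨x, rfl, rfl⟩
      exact (e x).2
  simp only [HasHullVertices, HasHulls, hmem]
  constructor
  · rintro H a₁ a₂ b₁ b₂ c₁ c₂ h₁ h₂ h₃ h₄ ⟨a, rfl, rfl⟩ ⟨g, hg⟩ ⟨h, hh⟩ ⟨b, rfl, rfl⟩ ⟨p, hp⟩
      ⟨q, hq⟩ ⟨c, rfl, rfl⟩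
    exact H a b c g h p q ⟨h₁, h₃, hg.1, hg.2, hh.1, hh.2⟩ ⟨h₂, h₄, hp.1, hp.2, hq.1, hq.2⟩
  · rintro H a b c g h p q ⟨h₁, h₂, h₃, h₄, h₅, h₆⟩ ⟨k₁, k₂, k₃, k₄, k₅, k₆⟩
    exact H _ _ _ _ _ _ h₁ k₁ h₂ k₂ ⟨a, rfl, rfl⟩ ⟨g, h₃, h₄⟩ ⟨h, h₅, h₆⟩ ⟨b, rfl, rfl⟩
      ⟨p, k₃, k₄⟩ ⟨q, k₅, k₆⟩ ⟨c, rfl, rfl⟩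

end FullSublattices

/-! ### Chains in finite orders -/

section Chains

/-- Dilworth's theorem for width two, in terms of a colouring by two chains. Following Galvin:
remove a maximal element `a`, cover the rest by two chains, and let `x i` be the largest
element of the `i`-th chain that lies in an antichain of size two. Then `a` lies above some
`x i`, so `a` and the elements of the `i`-th chain up to `x i` form a chain, and the elements not
in this chain are pairwise comparable by the choice of `x i`. -/
theorem exists_two_chain_colouring {α : Type*} [PartialOrder α] (s : Finset α)
    (hs : ∀ p ∈ s, ∀ q ∈ s, ∀ r ∈ s, (p ≤ q ∨ q ≤ p) ∨ (p ≤ r ∨ r ≤ p) ∨ (q ≤ r ∨ r ≤ q)) :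
    ∃ f : α → Bool, ∀ p ∈ s, ∀ q ∈ s, f p = f q → p ≤ q ∨ q ≤ p := by
  classical
  induction hn : s.card generalizing s with
  | zero => exact ⟨fun _ => true, by simp [Finset.card_eq_zero.1 hn]⟩
  | succ n ih =>
    have hne : s.Nonempty := Finset.card_pos.1 (by omega)
    obtain ⟨a, ha⟩ := s.exists_maximal hne
    have hmax : ∀ z ∈ s, a ≤ z → z ≤ a := fun z hz h => ha.2 hz h
    obtain ⟨f, hf⟩ := ih (s.erase a)
      (fun p hp q hq r hr => hs p (Finset.mem_of_mem_erase hp) q (Finset.mem_of_mem_erase hq) r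
        (Finset.mem_of_mem_erase hr)) (by rw [Finset.card_erase_of_mem ha.1, hn]; rfl)
    by_cases hchain : ∀ p ∈ s.erase a, ∀ q ∈ s.erase a, p ≤ q ∨ q ≤ p
    · refine ⟨fun z => decide (z = a), fun p hp q hq hpq => ?_⟩
      rw [decide_eq_decide] at hpq
      by_cases h : p = a
      · rw [h, hpq.1 h]; exact .inl le_rfl
      · exact hchain p (Finset.mem_erase.2 ⟨h, hp⟩) q (Finset.mem_erase.2 ⟨mt hpq.2 h, hq⟩)
    push Not at hchain
    obtain ⟨u, hu, v, hv, huv, hvu⟩ := hchain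
    have hfuv : f u ≠ f v := fun h => (hf u hu v hv h).elim huv hvu
    let T : Bool → Finset α := fun i =>
      {z ∈ s.erase a | f z = i ∧ ∃ w ∈ s.erase a, ¬ z ≤ w ∧ ¬ w ≤ z}
    have hTne : ∀ i, (T i).Nonempty := by
      intro i
      by_cases h : f u = i
      · exact ⟨u, Finset.mem_filter.2 ⟨hu, h, v, hv, huv, hvu⟩⟩
      · refine ⟨v, Finset.mem_filter.2 ⟨hv, ?_, u, hu, hvu, huv⟩⟩
        revert h hfuv; cases f u <;> cases f v <;> cases i <;> simp
    have hx : ∀ i, ∃ x ∈ T i, ∀ z ∈ T i, z ≤ x := by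
      intro i
      obtain ⟨x, hx⟩ := (T i).exists_maximal (hTne i)
      refine ⟨x, hx.1, fun z hz => ?_⟩
      have hx' := Finset.mem_filter.1 hx.1
      have hz' := Finset.mem_filter.1 hz
      rcases hf x hx'.1 z hz'.1 (hx'.2.1.trans hz'.2.1.symm) with h | h
      · exact hx.2 hz h
      · exact h
    choose x hxT hxmax using hx
    have hxs : ∀ i, x i ∈ s.erase a ∧ f (x i) = i ∧ ∃ w ∈ s.erase a, ¬ x i ≤ w ∧ ¬ w ≤ x i :=
      fun i => Finset.mem_filter.1 (hxT i)
    -- An incomparable partner of `x i` has the other colour, so it lies below `x !i`.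
    have hnle : ∀ i, ¬ x (!i) ≤ x i := by
      intro i hle
      obtain ⟨hxi, hfi, w, hw, h₁, h₂⟩ := hxs i
      have hfw : f w = !i := by
        have : f (x i) ≠ f w := fun h => (hf _ hxi _ hw h).elim h₁ h₂
        rw [hfi] at this
        revert this; cases f w <;> cases i <;> simp
      exact h₂ ((hxmax _ w (Finset.mem_filter.2 ⟨hw, hfw, x i, hxi, h₂, h₁⟩)).trans hle)
    obtain ⟨i, hi⟩ : ∃ i, x i ≤ a := by
      rcases hs (x true) (Finset.mem_of_mem_erase (hxs _).1) (x false)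
        (Finset.mem_of_mem_erase (hxs _).1) a ha.1 with (h | h) | (h | h) | (h | h)
      · exact absurd h (hnle false)
      · exact absurd h (hnle true)
      · exact ⟨_, h⟩
      · exact ⟨_, hmax _ (Finset.mem_of_mem_erase (hxs _).1) h⟩
      · exact ⟨_, h⟩
      · exact ⟨_, hmax _ (Finset.mem_of_mem_erase (hxs _).1) h⟩
    refine ⟨fun z => decide (z = a ∨ f z = i ∧ z ≤ x i), fun p hp q hq hpq => ?_⟩
    rw [decide_eq_decide] at hpq
    by_cases hpK : p = a ∨ f p = i ∧ p ≤ x i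
    · have hqK := hpq.1 hpK
      by_cases hpa : p = a
      · rcases hqK with h | h
        · rw [hpa, h]; exact .inl le_rfl
        · rw [hpa]; exact .inr (h.2.trans hi)
      · have hpK' := hpK.resolve_left hpa
        by_cases hqa : q = a
        · rw [hqa]; exact .inl (hpK'.2.trans hi)
        · exact hf p (Finset.mem_erase.2 ⟨hpa, hp⟩) q (Finset.mem_erase.2 ⟨hqa, hq⟩)
            (hpK'.1.trans (hqK.resolve_left hqa).1.symm)
    · have hqK := mt hpq.2 hpK
      have hp' : p ∈ s.erase a := Finset.mem_erase.2 ⟨fun h => hpK (.inl h), hp⟩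
      have hq' : q ∈ s.erase a := Finset.mem_erase.2 ⟨fun h => hqK (.inl h), hq⟩
      by_contra! hcon
      have hfpq : f p ≠ f q := fun h => (hf p hp' q hq' h).elim hcon.1 hcon.2
      by_cases hfp : f p = i
      · exact hpK (.inr ⟨hfp, hxmax i p (Finset.mem_filter.2 ⟨hp', hfp, q, hq', hcon.1, hcon.2⟩)⟩)
      · have hfq : f q = i := by
          revert hfp hfpq; cases f p <;> cases f q <;> cases i <;> simp
        exact hqK (.inr ⟨hfq, hxmax i q (Finset.mem_filter.2 ⟨hq', hfq, p, hp', hcon.2, hcon.1⟩)⟩)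

/-- Join-prime elements can be joined one after the other, maximal ones last, and each of them
makes the join strictly larger. -/
theorem exists_ltSeries_of_supPrime {L : Type*} [SemilatticeSup L] [OrderBot L] (s : Finset L)
    (hs : ∀ p ∈ s, SupPrime p) : ∃ p : LTSeries L, p.length = s.card ∧ p.last = s.sup id := by
  classical
  induction hn : s.card generalizing s with
  | zero => exact ⟨RelSeries.singleton _ ⊥, rfl, by simp [Finset.card_eq_zero.1 hn]⟩
  | succ n ih =>
    obtain ⟨a, ha⟩ := s.exists_maximal (Finset.card_pos.1 (by omega))
    obtain ⟨p, hp, hlast⟩ := ih (s.erase a) (fun q hq => hs q (Finset.mem_of_mem_erase hq))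
      (by rw [Finset.card_erase_of_mem ha.1, hn]; rfl)
    have hlt : p.last < s.sup id := by
      rw [hlast]
      refine lt_of_le_not_ge (Finset.sup_mono (Finset.erase_subset _ _)) fun h => ?_
      obtain ⟨b, hb, hab⟩ := (hs a ha.1).le_finset_sup.1 ((Finset.le_sup (f := id) ha.1).trans h)
      rw [Finset.mem_erase] at hb
      exact hb.1 (le_antisymm (ha.2 hb.2 hab) hab)
    exact ⟨p.snoc (s.sup id) hlt, by simp [hp], by simp⟩

end Chains

/-! ### Planar coordinates of a conditionally URC lattice -/

section Representation

variable {L : Type*} [DistribLattice L]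

/-- Three pairwise incomparable join-prime elements would generate a Boolean sublattice of rank
three above the join `e` of their pairwise meets, so an interval with several complementary sets. -/
theorem not_antichain_of_isConditionallyURC (hL : IsConditionallyURC L) {p q r : L}
    (hp : SupPrime p) (hq : SupPrime q) (hr : SupPrime r) :
    (p ≤ q ∨ q ≤ p) ∨ (p ≤ r ∨ r ≤ p) ∨ (q ≤ r ∨ r ≤ q) := by
  by_contra! hcon
  obtain ⟨⟨hpq, hqp⟩, ⟨hpr, hrp⟩, hqr, hrq⟩ := hcon
  obtain ⟨e, he⟩ : ∃ e, e = p ⊓ q ⊔ p ⊓ r ⊔ q ⊓ r := ⟨_, rfl⟩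
  have hpqe : p ⊓ q ≤ e := he ▸ le_sup_left.trans le_sup_left
  have hpre : p ⊓ r ≤ e := he ▸ le_sup_right.trans le_sup_left
  have hqre : q ⊓ r ≤ e := he ▸ le_sup_right
  have hpe : ¬ p ≤ e := by
    rw [he, hp.le_sup, hp.le_sup]
    rintro ((h | h) | h)
    · exact hpq (h.trans inf_le_right)
    · exact hpr (h.trans inf_le_right)
    · exact hpq (h.trans inf_le_left)
  have hqe : ¬ q ≤ e := by
    rw [he, hq.le_sup, hq.le_sup]
    rintro ((h | h) | h)
    · exact hqp (h.trans inf_le_left)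
    · exact hqp (h.trans inf_le_left)
    · exact hqr (h.trans inf_le_right)
  have hre : ¬ r ≤ e := by
    rw [he, hr.le_sup, hr.le_sup]
    rintro ((h | h) | h)
    · exact hrp (h.trans inf_le_left)
    · exact hrp (h.trans inf_le_left)
    · exact hrq (h.trans inf_le_left)
  have hinf₁ : (p ⊔ e) ⊓ (q ⊔ r ⊔ e) = e := by
    rw [← sup_inf_right, inf_sup_left, sup_eq_right]
    exact sup_le hpqe hpre
  have hinf₂ : (q ⊔ e) ⊓ (p ⊔ r ⊔ e) = e := by
    rw [← sup_inf_right, inf_sup_left, sup_eq_right, inf_comm q p]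
    exact sup_le hpqe hqre
  have hsup : (p ⊔ e) ⊔ (q ⊔ r ⊔ e) = (q ⊔ e) ⊔ (p ⊔ r ⊔ e) := by
    rw [← sup_sup_distrib_right, ← sup_sup_distrib_right, sup_left_comm]
  have hinc : ∀ {x y : L}, (x ⊔ e) ⊓ (y ⊔ e) = e → ¬ x ≤ e → ¬ x ⊔ e ≤ y ⊔ e := by
    intro x y hxy hx hle
    rw [inf_eq_left.2 hle] at hxy
    exact hx (le_sup_left.trans hxy.le)
  have hqr_e : ¬ q ⊔ r ≤ e := fun h => hqe (le_sup_left.trans h)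
  have hpr_e : ¬ p ⊔ r ≤ e := fun h => hpe (le_sup_left.trans h)
  have h := isConditionallyURC_iff.1 hL _ _ _ _ (hinc hinf₁ hpe)
    (hinc (by rwa [inf_comm]) hqr_e) (hinc hinf₂ hqe) (hinc (by rwa [inf_comm]) hpr_e)
    (hinf₁.trans hinf₂.symm) hsup
  rcases pair_eq_pair_iff.1 h with ⟨h, -⟩ | ⟨h, -⟩
  · exact (hp.le_sup.1 (le_sup_left.trans h.le)).elim hpq hpe
  · have hrle : r ≤ p ⊔ e := (le_sup_right.trans le_sup_left).trans h.ge
    exact (hr.le_sup.1 hrle).elim hrp hre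

/-- The number of join-irreducible elements of colour `c` below `a`. -/
noncomputable def countBelow (f : L → Bool) (c : Bool) (a : L) : ℕ :=
  {p | SupIrred p ∧ f p = c ∧ p ≤ a}.ncard

section Counting

variable {f : L → Bool}

theorem below_subset_or
    (hf : ∀ p q : L, SupIrred p → SupIrred q → f p = f q → p ≤ q ∨ q ≤ p)
    (c : Bool) (a b : L) :
    {p | SupIrred p ∧ f p = c ∧ p ≤ a} ⊆ {p | SupIrred p ∧ f p = c ∧ p ≤ b} ∨
      {p | SupIrred p ∧ f p = c ∧ p ≤ b} ⊆ {p | SupIrred p ∧ f p = c ∧ p ≤ a} := by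
  by_contra! hcon
  obtain ⟨p, ⟨hp, hpc, hpa⟩, hpb⟩ := Set.not_subset.1 hcon.1
  obtain ⟨q, ⟨hq, hqc, hqb⟩, hqa⟩ := Set.not_subset.1 hcon.2
  rcases hf p q hp hq (hpc.trans hqc.symm) with h | h
  · exact hpb ⟨hp, hpc, h.trans hqb⟩
  · exact hqa ⟨hq, hqc, h.trans hpa⟩

variable [Finite L]

theorem countBelow_sup
    (hf : ∀ p q : L, SupIrred p → SupIrred q → f p = f q → p ≤ q ∨ q ≤ p)
    (c : Bool) (a b : L) :
    countBelow f c (a ⊔ b) = max (countBelow f c a) (countBelow f c b) := by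
  have h : {p | SupIrred p ∧ f p = c ∧ p ≤ a ⊔ b} =
      {p | SupIrred p ∧ f p = c ∧ p ≤ a} ∪ {p | SupIrred p ∧ f p = c ∧ p ≤ b} := by
    ext p
    simp only [Set.mem_ofPred_eq, Set.mem_union]
    constructor
    · rintro ⟨hp, hpc, hle⟩
      exact (hp.supPrime.le_sup.1 hle).imp (fun h => ⟨hp, hpc, h⟩) fun h => ⟨hp, hpc, h⟩
    · rintro (⟨hp, hpc, h⟩ | ⟨hp, hpc, h⟩)
      · exact ⟨hp, hpc, le_sup_of_le_left h⟩
      · exact ⟨hp, hpc, le_sup_of_le_right h⟩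
  unfold countBelow
  rw [h]
  rcases below_subset_or hf c a b with h | h
  · rw [Set.union_eq_right.2 h, max_eq_right (Set.ncard_le_ncard h)]
  · rw [Set.union_eq_left.2 h, max_eq_left (Set.ncard_le_ncard h)]

theorem countBelow_inf
    (hf : ∀ p q : L, SupIrred p → SupIrred q → f p = f q → p ≤ q ∨ q ≤ p)
    (c : Bool) (a b : L) :
    countBelow f c (a ⊓ b) = min (countBelow f c a) (countBelow f c b) := by
  have h : {p | SupIrred p ∧ f p = c ∧ p ≤ a ⊓ b} =
      {p | SupIrred p ∧ f p = c ∧ p ≤ a} ∩ {p | SupIrred p ∧ f p = c ∧ p ≤ b} := by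
    ext p
    simp only [Set.mem_ofPred_eq, Set.mem_inter_iff, le_inf_iff]
    tauto
  unfold countBelow
  rw [h]
  rcases below_subset_or hf c a b with h | h
  · rw [Set.inter_eq_left.2 h, min_eq_left (Set.ncard_le_ncard h)]
  · rw [Set.inter_eq_right.2 h, min_eq_right (Set.ncard_le_ncard h)]

theorem below_eq_of_countBelow_eq
    (hf : ∀ p q : L, SupIrred p → SupIrred q → f p = f q → p ≤ q ∨ q ≤ p)
    {c : Bool} {a b : L} (h : countBelow f c a = countBelow f c b) :
    {p | SupIrred p ∧ f p = c ∧ p ≤ a} = {p | SupIrred p ∧ f p = c ∧ p ≤ b} := by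
  rcases below_subset_or hf c a b with hs | hs
  · exact Set.eq_of_subset_of_ncard_le hs h.ge
  · exact (Set.eq_of_subset_of_ncard_le hs h.le).symm

theorem isGrid_countBelow [OrderBot L]
    (hf : ∀ p q : L, SupIrred p → SupIrred q → f p = f q → p ≤ q ∨ q ≤ p) :
    IsGrid (fun a => (countBelow f true a : ℤ)) fun a => (countBelow f false a : ℤ) where
  inj a b h₁ h₂ := by
    have h : ∀ p, SupIrred p → (p ≤ a ↔ p ≤ b) := by
      intro p hp
      have key : ∀ c, f p = c → countBelow f c a = countBelow f c b → (p ≤ a ↔ p ≤ b) := by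
        intro c hc h
        have := Set.ext_iff.1 (below_eq_of_countBelow_eq hf h) p
        simpa [hp, hc] using this
      cases hc : f p
      · exact key _ hc (by exact_mod_cast h₂)
      · exact key _ hc (by exact_mod_cast h₁)
    have hle : ∀ a b : L, (∀ p, SupIrred p → p ≤ a → p ≤ b) → a ≤ b := by
      intro a b h
      obtain ⟨s, rfl, hs⟩ := exists_supIrred_decomposition a
      exact Finset.sup_le fun p hp => h p (hs hp) (Finset.le_sup (f := id) hp)
    exact le_antisymm (hle _ _ fun p hp => (h p hp).1) (hle _ _ fun p hp => (h p hp).2)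
  X_sup a b := by rw [countBelow_sup hf]; push_cast; rfl
  X_inf a b := by rw [countBelow_inf hf]; push_cast; rfl
  Y_sup a b := by rw [countBelow_sup hf]; push_cast; rfl
  Y_inf a b := by rw [countBelow_inf hf]; push_cast; rfl

end Counting

/-- The sublattice of `ℤ × ℤ` of all values of the coordinates. -/
def IsGrid.range {L : Type*} [Lattice L] {X Y : L → ℤ} (h : IsGrid X Y) : Sublattice (ℤ × ℤ) where
  carrier := Set.range fun a => (X a, Y a)
  supClosed' := by
    rintro _ ⟨a, rfl⟩ _ ⟨b, rfl⟩
    exact ⟨a ⊔ b, Prod.ext (h.X_sup a b) (h.Y_sup a b)⟩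
  infClosed' := by
    rintro _ ⟨a, rfl⟩ _ ⟨b, rfl⟩
    exact ⟨a ⊓ b, Prod.ext (h.X_inf a b) (h.Y_inf a b)⟩

theorem IsGrid.nonempty_orderIso {L : Type*} [Lattice L] {X Y : L → ℤ} (h : IsGrid X Y) :
    Nonempty (L ≃o h.range) := by
  let g : L → h.range := fun a => ⟨(X a, Y a), a, rfl⟩
  have hg : Function.Bijective g := by
    constructor
    · intro a b hab
      have := Prod.ext_iff.1 (Subtype.ext_iff.1 hab)
      exact h.inj a b this.1 this.2
    · rintro ⟨_, a, rfl⟩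
      exact ⟨a, rfl⟩
  exact ⟨⟨Equiv.ofBijective g hg, fun {a b} => (h.le_iff (a := a) (b := b)).symm⟩⟩

/-- A conditionally URC lattice is planar: its join-irreducible elements form two chains, and
counting them below an element gives its coordinates. -/
theorem exists_isFullSublattice_of_isConditionallyURC [Finite L] [Nonempty L]
    (hL : IsConditionallyURC L) :
    ∃ (m n : ℕ) (D : Sublattice (ℤ × ℤ)), IsFullSublattice m n D ∧ Nonempty (L ≃o D) := by
  classical
  have := Fintype.ofFinite L
  let _ : BoundedOrder L := Fintype.toBoundedOrder L
  let J : Finset L := {p | SupIrred p}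
  have hJ : ∀ p, p ∈ J ↔ SupIrred p := by simp [J]
  obtain ⟨f, hf⟩ := exists_two_chain_colouring J fun p hp q hq r hr =>
    not_antichain_of_isConditionallyURC hL ((hJ p).1 hp).supPrime ((hJ q).1 hq).supPrime
      ((hJ r).1 hr).supPrime
  have hf' : ∀ p q : L, SupIrred p → SupIrred q → f p = f q → p ≤ q ∨ q ≤ p :=
    fun p q hp hq => hf p ((hJ p).2 hp) q ((hJ q).2 hq)
  have hG := isGrid_countBelow hf'
  obtain ⟨e⟩ := hG.nonempty_orderIso
  refine ⟨countBelow f true ⊤, countBelow f false ⊤, hG.range, ⟨?_, ?_⟩, ⟨e⟩⟩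
  · rintro _ ⟨a, rfl⟩
    have h := hG.le_iff.1 (le_top : a ≤ ⊤)
    exact ⟨Prod.le_def.2 ⟨by positivity, by positivity⟩, Prod.le_def.2 h⟩
  · obtain ⟨p, hp, -⟩ := exists_ltSeries_of_supPrime J fun p hp => ((hJ p).1 hp).supPrime
    refine ⟨p.map e e.strictMono, hp.trans ?_⟩
    have hcount : ∀ c, countBelow f c ⊤ = (J.filter fun p => f p = c).card := by
      intro c
      rw [countBelow, ← Set.ncard_coe_finset]
      congr 1
      ext p
      simp [hJ]
    rw [hcount, hcount, ← Finset.card_filter_add_card_filter_not (s := J) (fun p => f p = true)]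
    simp

end Representation

end Hibi

theorem mainTheorem2 {L : Type*} [DistribLattice L] [Finite L] [Nonempty L]
    {K : Type*} [Field K] (ord : MonomialOrder L) (hord : Hibi.IsRankLex ord) :
    List.TFAE [
      Hibi.IsReducedGroebnerBasis ord (Hibi.hibiIdeal L K) (Hibi.monicHibiRelations L K),
      (∀ a b : L, ¬ a ≤ b → ¬ b ≤ a →
          Hibi.IsIndispensable (Hibi.hibiIdeal L K) (Hibi.hibiRelation K a b)) ∧
        ∃ G : Set (MvPolynomial L K),
          Hibi.IsReducedGroebnerBasis ord (Hibi.hibiIdeal L K) G ∧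
          ∀ f ∈ G, f.IsHomogeneous 2,
      Hibi.IsConditionallyURC L ∧
        ∀ a b c : L, a < b → b < c → Hibi.IsComplementedInterval b c →
          ∀ g h : L, Hibi.IsComplementarySet a b g h →
            Hibi.IsComplementedInterval g c ∨ Hibi.IsComplementedInterval h c,
      ∃ (m n : ℕ) (D : Sublattice (ℤ × ℤ)),
        Hibi.IsChainLadder m n D ∧ (∀ p : ℤ × ℤ, ¬ Hibi.IsCriticalCorner D p) ∧
        Nonempty (L ≃o D)] := by
  tfae_have 1 ↔ 2 := Hibi.isReducedGroebnerBasis_iff_indispensable K hord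
  tfae_have 1 → 3 := by
    intro h
    obtain ⟨hL, hred⟩ := (Hibi.isReducedGroebnerBasis_iff hord).1 h
    exact ⟨hL, fun a b c _ hbc hc g h hgh =>
      Hibi.isComplementedInterval_of_hasReductions hord hred hbc hc hgh⟩
  tfae_have 3 → 4 := by
    rintro ⟨hL, h⟩
    obtain ⟨m, n, D, hD, ⟨e⟩⟩ := Hibi.exists_isFullSublattice_of_isConditionallyURC hL
    have H := (Hibi.hasHullVertices_iff_of_orderIso e).1
      ((Hibi.isGrid_of_orderIso e).hasHullVertices_iff.2 h)
    obtain ⟨hladder, hcrit⟩ := Hibi.isChainLadder_and_iff.2 ⟨hD, H⟩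
    exact ⟨m, n, D, hladder, hcrit, ⟨e⟩⟩
  tfae_have 4 → 1 := by
    rintro ⟨m, n, D, hladder, hcrit, ⟨e⟩⟩
    have hG := Hibi.isGrid_of_orderIso e
    have H := (Hibi.hasHullVertices_iff_of_orderIso e).2
      (Hibi.isChainLadder_and_iff.1 ⟨hladder, hcrit⟩).2
    exact (Hibi.isReducedGroebnerBasis_iff hord).2 ⟨hG.isConditionallyURC, hG.hasReductions H hord⟩
  tfae_finish
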